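/- Let $n,d\ge 0$ be integers and $B^n\subset\mathbb R^n$ the closed unit ball. For a function $f$ of class $C^{l}$ on $B^n$ put $$M_l(f)=\max_{x\in B^n}\ \sum_{(i_1,\dots,i_l)\in\{1,\dots,n\}^l}\Bigl|\frac{\partial^l f}{\partial x_{i_1}\cdots\partial x_{i_l}}(x)\Bigr| .$$ Let $\bar C(n,d)$ be the least constant $C\ge 0$ such that $M_k(p)\le C\,M_0(p)$ for all real polynomials $p$ of degree at most $d$ in $n$ variables and all $k=1,\dots,d$, and put $C_3=C_3(n,d)=C_1+C_2$, where $$C_1=\bar C(n,d),\qquad C_2=\frac{\bar C(n,d)}{(d+1)!}+\frac1{(d-1)!}$$ (for $d=0$ read $(d-1)!$ as $1$). For $\gamma>0$ let $$T(\gamma)=\min\Bigl\{1,\frac{d!\,\gamma^2}{4C_3}\Bigr\}.$$ **Theorem 7.1.** Let $\gamma>0$ and let $f$ be a $C^{d+1}$ function on $B^n$ with $M_0(f)=1$. Assume that $f$ does not vanish on $B^n$ outside the concentric closed ball of radius $\tfrac12$, and that $0$ is a $\gamma$-regular value of $f$, i.e. $\|\operatorname{grad} f(x)\|\ge\gamma$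 (Euclidean norm) for all $x\in B^n$ with $f(x)=0$. Let $P$ be the Taylor polynomial of $f$ of degree $d$ at the origin. If $M_{d+1}(f)\le T(\gamma)$, then the zero set $Y_0(f)=\{x\in B^n: f(x)=0\}$ has finitely many connected components $V_1,\dots,V_q$, and there are $q$ distinct connected components $W_1,\dots,W_q$ of the real algebraic set $\{x\in\mathbb R^n: P(x)=0\}$, all of them smooth (that is, $\operatorname{grad}P\neq0$ at all their points), such that $Y_0(f)=\bigcup_i V_i$ is $C^{d+1}$-smoothly isotopic inside $B^n$ to $W=\bigcup_{i=1}^q W_i$. Here $Y$ and $W$ are called $C^{k}$-smoothly isotopic inside $B^n$ if there is a $C^k$ map $H:Y\times[0,1]\to B^n$ such that each $H(\cdot,\tau)$, $\tau\in[0,1]$, is a $C^k$ diffeomorphism of $Y$ onto its image, $H(y,0)=y$ for $y\in Y$, and $H(Y,1)=W$. A map on a subset of a Euclidean space is $C^k$ if near each point of the subset it extends to a $C^k$ map on an open set. -/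

import Mathlib

open scoped Nat

noncomputable section

namespace SmoothRigidity

/-- The closed unit ball `B^n` of Euclidean space. -/
abbrev unitBall (n : ℕ) : Set (EuclideanSpace ℝ (Fin n)) :=
  Metric.closedBall 0 1

/-- The norm of the `l`-th derivative of `f` at `x ∈ B^n`: the sum of the absolute values of all
the partial derivatives `∂_{w 0} ⋯ ∂_{w (l-1)} f (x)`, over all `w ∈ {1,…,n}^l`. On the closed ball
derivatives are taken within the ball (one-sided at the boundary). -/
def derivNorm {n : ℕ} (l : ℕ) (f : EuclideanSpace ℝ (Fin n) → ℝ)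
    (x : EuclideanSpace ℝ (Fin n)) : ℝ :=
  ∑ w : Fin l → Fin n,
    |iteratedFDerivWithin ℝ l f (unitBall n) x (fun j => EuclideanSpace.single (w j) (1 : ℝ))|

/-- `M_l(f)`, the maximum over `B^n` of the norm of the `l`-th derivative. -/
def M {n : ℕ} (l : ℕ) (f : EuclideanSpace ℝ (Fin n) → ℝ) : ℝ :=
  sSup (derivNorm l f '' unitBall n)

/-- The real polynomial function on `ℝ^n` given by `p`. -/
def polyFun {n : ℕ} (p : MvPolynomial (Fin n) ℝ) (x : EuclideanSpace ℝ (Fin n)) : ℝ :=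
  MvPolynomial.eval (fun i => x i) p

/-- The norm-equivalence constant of polynomials of degree at most `d` on `B^n`: the least `C ≥ 0`
with `M_k(p) ≤ C * M_0(p)` for all real polynomials `p` of degree at most `d` and `k = 1,…,d`. -/
def polyConst (n d : ℕ) : ℝ :=
  sInf {C : ℝ | 0 ≤ C ∧ ∀ p : MvPolynomial (Fin n) ℝ, p.totalDegree ≤ d →
    ∀ k ∈ Finset.Icc 1 d, M k (polyFun p) ≤ C * M 0 (polyFun p)}

/-- The constant `C_1(n,d)` in the bound `M_k(f) ≤ C_1 M_0(f) + C_2 M_{d+1}(f)`. -/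
def C₁ (n d : ℕ) : ℝ := polyConst n d

/-- The constant `C_2(n,d)` in the bound `M_2(f) ≤ C_1 M_0(f) + C_2 M_{d+1}(f)`, that is,
`C_2 = polyConst / (d+1)! + 1 / (d-k+1)!` for `k = 2`. It is meant for `d ≥ 1`; for `d = 0`
the last summand is `1`. -/
def C₂ (n d : ℕ) : ℝ := polyConst n d / ((d + 1)! : ℝ) + 1 / ((d - 1)! : ℝ)

/-- `C_3(n,d) = C_1(n,d) + C_2(n,d)`. -/
def C₃ (n d : ℕ) : ℝ := C₁ n d + C₂ n d

/-- The threshold `T(γ) = min {1, d! γ² / (4 C_3)}`. -/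
def T (n d : ℕ) (γ : ℝ) : ℝ := min 1 ((d ! : ℝ) * γ ^ 2 / (4 * C₃ n d))

/-- `c` is a `γ`-regular value of `f` on `B^n`: the Euclidean norm of the gradient is at least `γ`
at all points of `B^n` where `f = c`. -/
def IsGammaRegularValue {n : ℕ} (γ : ℝ) (f : EuclideanSpace ℝ (Fin n) → ℝ) (c : ℝ) : Prop :=
  ∀ x ∈ unitBall n, f x = c → γ ≤ ‖gradientWithin f (unitBall n) x‖

/-- The level set `Y_0(f) = {x ∈ B^n | f x = 0}` of a function on `B^n`. -/
def zeroLevel {n : ℕ} (f : EuclideanSpace ℝ (Fin n) → ℝ) : Set (EuclideanSpace ℝ (Fin n)) :=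
  {x | x ∈ unitBall n ∧ f x = 0}

/-- The Taylor polynomial of degree `d` at the origin of a function on `B^n`, as a function on
the whole of `ℝ^n`: `P(x) = ∑_{k ≤ d} D^k f(0)(x,…,x) / k!`. -/
def taylorPoly {n : ℕ} (d : ℕ) (f : EuclideanSpace ℝ (Fin n) → ℝ)
    (x : EuclideanSpace ℝ (Fin n)) : ℝ :=
  ∑ k ∈ Finset.range (d + 1),
    iteratedFDerivWithin ℝ k f (unitBall n) 0 (fun _ => x) / (k ! : ℝ)

/-- The set of connected components of a subset `S` of a space. -/
def components {X : Type*} [TopologicalSpace X] (S : Set X) : Set (Set X) :=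
  {C | ∃ x ∈ S, C = connectedComponentIn S x}

/-- A map on an arbitrary subset `S` of a normed space is of class `C^k` if near every point of `S`
it extends to a `C^k` map on an open set. -/
def IsCkOn {E F : Type*} [NormedAddCommGroup E] [NormedSpace ℝ E] [NormedAddCommGroup F]
    [NormedSpace ℝ F] (k : WithTop ℕ∞) (h : E → F) (S : Set E) : Prop :=
  ∀ x ∈ S, ∃ U : Set E, IsOpen U ∧ x ∈ U ∧
    ∃ g : E → F, ContDiffOn ℝ k g U ∧ Set.EqOn h g (S ∩ U)

/-- `h` restricts to a `C^k` diffeomorphism of `S` onto its image `h(S)`. -/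
def IsCkDiffeoOntoImage {E F : Type*} [NormedAddCommGroup E] [NormedSpace ℝ E]
    [NormedAddCommGroup F] [NormedSpace ℝ F] (k : WithTop ℕ∞) (h : E → F) (S : Set E) : Prop :=
  IsCkOn k h S ∧ ∃ g : F → E, IsCkOn k g (h '' S) ∧ ∀ x ∈ S, g (h x) = x

/-- `Y` and `Z` are `C^k`-isotopic inside `N`: there is a map `H : Y × [0,1] → N`, jointly of class
`C^k`, such that each `H(·,τ)` is a `C^k` diffeomorphism of `Y` onto its image (an embedding),
`H(·,0)` is the inclusion of `Y`, and `H(·,1)` maps `Y` onto `Z`. -/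
def IsotopicIn {E : Type*} [NormedAddCommGroup E] [NormedSpace ℝ E] (k : WithTop ℕ∞)
    (N Y Z : Set E) : Prop :=
  ∃ H : E × ℝ → E,
    IsCkOn k H (Y ×ˢ Set.Icc (0 : ℝ) 1) ∧
    (∀ y ∈ Y, ∀ τ ∈ Set.Icc (0 : ℝ) 1, H (y, τ) ∈ N) ∧
    (∀ τ ∈ Set.Icc (0 : ℝ) 1, IsCkDiffeoOntoImage k (fun y => H (y, τ)) Y) ∧
    (∀ y ∈ Y, H (y, 0) = y) ∧
    (fun y => H (y, 1)) '' Y = Z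

end SmoothRigidity

end

open scoped Gradient Topology RealInnerProductSpace ContDiff
open Metric Set Filter

/-! Write `K = C₃` and `Y` for the zero set of `f`, assumed nonempty. Taylor's inequality and the
threshold make `f - P` small in `C^1`: the gradients differ by at most `γ / 4` on the open ball and
by at most `γ / 8` on `Y`, and `|P| ≤ γ² / (32 K)` on `Y`. The constants also bound the second
derivative of `P`, so `∇P` is `K`-Lipschitz. This is `isNearbyZeroSet_taylorPoly`; all the geometry
uses only its conclusion.

A `K`-Lipschitz gradient gives the regular zeros of `P` in the ball an embedded normal tube `w + s
∇P(w)`, `|s| K < 1/2` (`IsTubePoint.eq_of_normalMap_eq`, `IsTubePoint.exists_local_inverse`). At a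
point of `Y`, `P` is small and its gradient is not, so a zero of `P` lies within `γ / (16 K)`; the
nearest zero is the foot of a perpendicular, and `Y` lies in the tube (`exists_foot`). Since `∇f`
stays close to `∇P(w)` along the normal at `w`, two points of `Y` cannot share a foot
(`eq_of_foot_eq`), and by the implicit function theorem `Y` is locally a smooth graph over the zero
set of `P` (`exists_local_section`).

Hence sliding `Y` along the normals to its feet is an isotopy. The set of feet is compact and open
in the whole zero set of `P`, so it is a union of components, matched one to one with those of `Y`
(`exists_isotopy`). -/

namespace SmoothRigidity

/-! ### Normal tube around the zero set of a function with Lipschitz gradient -/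

section NormalTube

variable {E : Type*} [NormedAddCommGroup E] [InnerProductSpace ℝ E] [FiniteDimensional ℝ E]

/-- The normal map `(w, s) ↦ w + s ∇P(w)` of a function `P`. -/
noncomputable def normalMap (P : E → ℝ) (q : E × ℝ) : E := q.1 + q.2 • ∇ P q.1

/-- Parameters of the points of the normal tube of radius `1 / (2 K)` around the regular part of
the zero set of `P` in the open unit ball. -/
structure IsTubePoint (K : ℝ) (P : E → ℝ) (q : E × ℝ) : Prop where
  mem_ball : q.1 ∈ ball (0 : E) 1
  eq_zero : P q.1 = 0
  gradient_ne_zero : ∇ P q.1 ≠ 0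
  abs_mul_lt : |q.2| * K < 1 / 2

lemma contDiff_gradient {P : E → ℝ} (hP : ContDiff ℝ ω P) : ContDiff ℝ ω (∇ P) := by
  have h : ContDiff ℝ ω (fderiv ℝ P) := hP.fderiv_right le_rfl
  exact (InnerProductSpace.toDual ℝ E).symm.contDiff.comp h

lemma contDiff_normalMap {P : E → ℝ} (hP : ContDiff ℝ ω P) : ContDiff ℝ ω (normalMap P) :=
  contDiff_fst.add (contDiff_snd.smul ((contDiff_gradient hP).comp contDiff_fst))

lemma fderiv_eq_inner_gradient (P : E → ℝ) (x v : E) : fderiv ℝ P x v = ⟪∇ P x, v⟫ := by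
  rw [inner_gradient_left]

lemma norm_fderiv_sub_fderiv (P Q : E → ℝ) (x y : E) :
    ‖fderiv ℝ P x - fderiv ℝ Q y‖ = ‖∇ P x - ∇ Q y‖ := by
  rw [← toDual_gradient, ← toDual_gradient, ← map_sub, LinearIsometryEquiv.norm_map]

/-- Quadratic bound for the first order expansion of a function with Lipschitz gradient. -/
lemma abs_sub_sub_inner_gradient_le {P : E → ℝ} {K : ℝ} {s : Set E} (hK : 0 ≤ K)
    (hs : Convex ℝ s) (hP : Differentiable ℝ P)
    (hL : ∀ x ∈ s, ∀ y ∈ s, ‖∇ P y - ∇ P x‖ ≤ K * ‖y - x‖) {x y : E} (hx : x ∈ s) (hy : y ∈ s) :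
    |P y - P x - ⟪∇ P x, y - x⟫| ≤ K * ‖y - x‖ ^ 2 := by
  have hseg : segment ℝ x y ⊆ s := hs.segment_subset hx hy
  have : ‖P y - P x - fderiv ℝ P x (y - x)‖ ≤ K * ‖y - x‖ * ‖y - x‖ :=
    (convex_segment x y).norm_image_sub_le_of_norm_fderiv_le' (fun z _ => hP z) (fun z hz => by
      rw [norm_fderiv_sub_fderiv]
      refine (hL x hx z (hseg hz)).trans (mul_le_mul_of_nonneg_left ?_ hK)
      exact norm_sub_le_of_mem_segment hz) (left_mem_segment ℝ x y) (right_mem_segment ℝ x y)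
  rw [fderiv_eq_inner_gradient, Real.norm_eq_abs] at this
  rwa [pow_two, ← mul_assoc]

/-- The normal map is injective on the tube. -/
lemma IsTubePoint.eq_of_normalMap_eq {P : E → ℝ} {K : ℝ} (hK : 0 ≤ K) (hP : Differentiable ℝ P)
    (hL : ∀ x ∈ ball (0 : E) 1, ∀ y ∈ ball (0 : E) 1, ‖∇ P y - ∇ P x‖ ≤ K * ‖y - x‖)
    {q q' : E × ℝ} (hq : IsTubePoint K P q) (hq' : IsTubePoint K P q')
    (h : normalMap P q = normalMap P q') : q = q' := by
  obtain ⟨w, s⟩ := q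
  obtain ⟨w', s'⟩ := q'
  obtain ⟨hw, hPw, hgw, hs⟩ := hq
  obtain ⟨hw', hPw', hgw', hs'⟩ := hq'
  simp only [normalMap] at *
  have h1 := abs_sub_sub_inner_gradient_le hK (convex_ball _ _) hP hL hw hw'
  have h2 := abs_sub_sub_inner_gradient_le hK (convex_ball _ _) hP hL hw' hw
  rw [hPw, hPw', sub_self, zero_sub, abs_neg] at h1 h2
  rw [norm_sub_rev w w', ← neg_sub w' w, inner_neg_right, abs_neg] at h2
  have hdiff : w' - w = s • ∇ P w - s' • ∇ P w' := by
    rw [sub_eq_sub_iff_add_eq_add, add_comm w', add_comm w] at *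
    rw [← sub_eq_zero] at h ⊢
    rw [← neg_eq_zero, ← h]; abel
  have h3 : ‖w' - w‖ ^ 2 = s * ⟪∇ P w, w' - w⟫ - s' * ⟪∇ P w', w' - w⟫ := by
    rw [← real_inner_self_eq_norm_sq]
    nth_rw 1 [hdiff]
    rw [inner_sub_left, real_inner_smul_left, real_inner_smul_left]
  -- Both endpoints are zeros of `P`, so each gradient is almost orthogonal to `w' - w`, up to `K
  -- ‖w' - w‖²`. As `(|s| + |s'|) K < 1`, this forces `w' = w`.
  have h4 : ‖w' - w‖ ^ 2 ≤ |s| * (K * ‖w' - w‖ ^ 2) + |s'| * (K * ‖w' - w‖ ^ 2) := by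
    calc ‖w' - w‖ ^ 2 ≤ |s * ⟪∇ P w, w' - w⟫| + |s' * ⟪∇ P w', w' - w⟫| := by
          rw [h3]
          exact (le_abs_self _).trans (abs_sub _ _)
      _ ≤ _ := by
          rw [abs_mul, abs_mul]
          gcongr
  have hww : w' = w := by
    by_contra hne
    have : 0 < ‖w' - w‖ ^ 2 := by
      have := norm_pos_iff.2 (sub_ne_zero.2 hne)
      positivity
    nlinarith
  subst hww
  have h5 : (s - s') • ∇ P w' = 0 := by rw [sub_smul, ← hdiff, sub_self]
  rw [smul_eq_zero, sub_eq_zero] at h5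
  exact Prod.ext rfl (h5.resolve_right hgw)

/-- Every condition on a tube point except the vanishing of `P` is open. -/
lemma IsTubePoint.eventually {P : E → ℝ} {K : ℝ} (hP : ContDiff ℝ ω P) {q₀ : E × ℝ}
    (hq₀ : IsTubePoint K P q₀) :
    ∀ᶠ q in 𝓝 q₀, P q.1 = 0 → IsTubePoint K P q := by
  have h1 : ∀ᶠ q : E × ℝ in 𝓝 q₀, q.1 ∈ ball (0 : E) 1 :=
    continuous_fst.continuousAt.eventually_mem (isOpen_ball.mem_nhds hq₀.mem_ball)
  have h2 : ∀ᶠ q : E × ℝ in 𝓝 q₀, ∇ P q.1 ≠ 0 :=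
    ((contDiff_gradient hP).continuous.comp continuous_fst).continuousAt.eventually_ne
      hq₀.gradient_ne_zero
  have h3 : ∀ᶠ q : E × ℝ in 𝓝 q₀, |q.2| * K < 1 / 2 :=
    ((continuous_snd.abs.mul continuous_const).continuousAt).eventually_lt continuousAt_const
      hq₀.abs_mul_lt
  filter_upwards [h1, h2, h3] with q h1 h2 h3 h
  exact ⟨h1, h, h2, h3⟩

/-- The inverse of the normal map near a point of the tube. -/
lemma IsTubePoint.exists_local_inverse {P : E → ℝ} {K : ℝ} (hK : 0 ≤ K) (hP : ContDiff ℝ ω P)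
    (hL : ∀ x ∈ ball (0 : E) 1, ∀ y ∈ ball (0 : E) 1, ‖∇ P y - ∇ P x‖ ≤ K * ‖y - x‖)
    {q₀ : E × ℝ} (hq₀ : IsTubePoint K P q₀) :
    ∃ r : E → E × ℝ, ContDiffAt ℝ ω r (normalMap P q₀) ∧ r (normalMap P q₀) = q₀ ∧
      ∀ᶠ z in 𝓝 (normalMap P q₀), IsTubePoint K P (r z) ∧ normalMap P (r z) = z := by
  obtain ⟨w, s⟩ := q₀
  set A : E →L[ℝ] E := fderiv ℝ (∇ P) w with hA
  have hgd : Differentiable ℝ (∇ P) := (contDiff_gradient hP).differentiable (by simp)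
  have hAK : ‖A‖ ≤ K := by
    refine (hgd w).hasFDerivAt.le_of_lip' hK ?_
    filter_upwards [isOpen_ball.mem_nhds hq₀.mem_ball] with y hy using hL w hq₀.mem_ball y hy
  -- With the value of `P` as an extra coordinate, the zero set becomes a slice, and the inverse
  -- function theorem applies in `E × ℝ` without charts on the zero set.
  let Φ : E × ℝ → E × ℝ := fun q => (normalMap P q, P q.1)
  have hΦ : ContDiff ℝ ω Φ := (contDiff_normalMap hP).prodMk (hP.comp contDiff_fst)
  let L : E × ℝ →L[ℝ] E × ℝ :=
    (ContinuousLinearMap.fst ℝ E ℝ + (s • A.comp (ContinuousLinearMap.fst ℝ E ℝ) +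
      (ContinuousLinearMap.snd ℝ E ℝ).smulRight (∇ P w))).prod
      ((fderiv ℝ P w).comp (ContinuousLinearMap.fst ℝ E ℝ))
  have hL' : HasFDerivAt Φ L (w, s) := by
    refine HasFDerivAt.prodMk (hasFDerivAt_fst.add ?_) ?_
    · exact HasFDerivAt.smul (hasFDerivAt_snd (𝕜 := ℝ) (p := (w, s)))
        (HasFDerivAt.comp (w, s) (g := ∇ P) (hgd w).hasFDerivAt hasFDerivAt_fst)
    · exact HasFDerivAt.comp (w, s) (g := P) (hP.differentiable (by simp) w).hasFDerivAt
        hasFDerivAt_fst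
  -- A kernel vector `(h, σ)` has `h` orthogonal to `∇P(w)` and `‖h‖² = -s ⟪A h, h⟫`; since `|s| ‖A‖
  -- < 1/2`, `h = 0`, and then `σ = 0`.
  have hinj : Function.Injective L := by
    rw [injective_iff_map_eq_zero]
    rintro ⟨h, σ⟩ h0
    have e1 : h + (s • A h + σ • ∇ P w) = 0 := congrArg Prod.fst h0
    have e2 : ⟪∇ P w, h⟫ = 0 := by
      rw [← fderiv_eq_inner_gradient]; exact congrArg Prod.snd h0
    have e3 : ‖h‖ ^ 2 + s * ⟪A h, h⟫ = 0 := by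
      have := congrArg (fun v => ⟪v, h⟫) e1
      simpa [inner_add_left, real_inner_smul_left, e2] using this
    have e4 : |s * ⟪A h, h⟫| ≤ |s| * K * ‖h‖ ^ 2 := by
      rw [abs_mul, mul_assoc]
      gcongr
      calc |⟪A h, h⟫| ≤ ‖A h‖ * ‖h‖ := abs_real_inner_le_norm _ _
        _ ≤ K * ‖h‖ * ‖h‖ := by gcongr; exact A.le_of_opNorm_le hAK h
        _ = _ := by ring
    have e5 : h = 0 := by
      by_contra hne
      have h6 : 0 < ‖h‖ ^ 2 := by
        have := norm_pos_iff.2 hne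
        positivity
      have h7 := hq₀.abs_mul_lt
      have h8 := neg_abs_le (s * ⟪A h, h⟫)
      simp only at h7
      nlinarith
    subst e5
    have : σ • ∇ P w = 0 := by simpa using e1
    rw [smul_eq_zero] at this
    exact Prod.ext rfl (this.resolve_right hq₀.gradient_ne_zero)
  let e : (E × ℝ) ≃L[ℝ] (E × ℝ) :=
    (LinearEquiv.ofInjectiveEndo L.toLinearMap hinj).toContinuousLinearEquiv
  have he : HasFDerivAt Φ (e : E × ℝ →L[ℝ] E × ℝ) (w, s) := by
    convert! hL'
  have hΦat : ContDiffAt ℝ ω Φ (w, s) := hΦ.contDiffAt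
  have hω : (ω : WithTop ℕ∞) ≠ 0 := by simp
  let Ψ := hΦat.localInverse he hω
  have hΨ : ContDiffAt ℝ ω Ψ (Φ (w, s)) := hΦat.to_localInverse he hω
  have hΨ0 : Ψ (Φ (w, s)) = (w, s) := hΦat.localInverse_apply_image he hω
  have hΦΨ : ∀ᶠ p in 𝓝 (Φ (w, s)), Φ (Ψ p) = p :=
    (hΦat.hasStrictFDerivAt' he hω).eventually_right_inverse
  have hbase : Φ (w, s) = (normalMap P (w, s), 0) := Prod.ext rfl hq₀.eq_zero
  rw [hbase] at hΨ hΨ0 hΦΨ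
  have hι : ContDiffAt ℝ ω (fun z : E => (z, (0 : ℝ))) (normalMap P (w, s)) :=
    contDiffAt_id.prodMk contDiffAt_const
  have hr : ContDiffAt ℝ ω (fun z => Ψ (z, 0)) (normalMap P (w, s)) :=
    ContDiffAt.comp (normalMap P (w, s)) (g := Ψ) hΨ hι
  refine ⟨fun z => Ψ (z, 0), hr, hΨ0, ?_⟩
  have h1 : ∀ᶠ z in 𝓝 (normalMap P (w, s)), Φ (Ψ (z, 0)) = (z, 0) :=
    hι.continuousAt.eventually hΦΨ
  have h2 : ∀ᶠ z in 𝓝 (normalMap P (w, s)), P (Ψ (z, 0)).1 = 0 → IsTubePoint K P (Ψ (z, 0)) := by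
    have := hr.continuousAt
    rw [ContinuousAt, hΨ0] at this
    exact this.eventually (hq₀.eventually hP)
  filter_upwards [h1, h2] with z h1 h2
  exact ⟨h2 (congrArg Prod.snd h1), congrArg Prod.fst h1⟩

end NormalTube

/-! ### Feet of perpendiculars from the zero set of `f` to that of `P` -/

section NearbyZeroSets

variable {E : Type*} [NormedAddCommGroup E] [InnerProductSpace ℝ E] [FiniteDimensional ℝ E]

/-- `Y` is the zero set of `f` in the unit ball, and `P` is a `C^1`-small perturbation of `f` whose
gradient is Lipschitz with constant `K` and is at least about `γ` on `Y`. -/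
structure IsNearbyZeroSet (k : ℕ) (K γ : ℝ) (f P : E → ℝ) (Y : Set E) : Prop where
  ne_zero : k ≠ 0
  pos : 0 < γ
  le_const : γ ≤ K
  contDiff : ContDiff ℝ ω P
  contDiffOn : ContDiffOn ℝ k f (ball 0 1)
  lipschitz : ∀ x ∈ ball (0 : E) 1, ∀ y ∈ ball (0 : E) 1, ‖∇ P y - ∇ P x‖ ≤ K * ‖y - x‖
  gradient_close : ∀ x ∈ ball (0 : E) 1, ‖∇ f x - ∇ P x‖ ≤ γ / 4
  mem_iff : ∀ x ∈ ball (0 : E) 1, x ∈ Y ↔ f x = 0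
  subset : Y ⊆ closedBall 0 (1 / 2)
  le_gradient : ∀ y ∈ Y, 7 / 8 * γ ≤ ‖∇ P y‖
  abs_apply_le : ∀ y ∈ Y, |P y| ≤ γ ^ 2 / (32 * K)

/-- `q = (w, s)` where `w` is the foot on the zero set of `P` of the perpendicular from `y`, and
`y = w + s ∇P(w)`. -/
structure IsFoot (K γ : ℝ) (P : E → ℝ) (y : E) (q : E × ℝ) : Prop where
  tube : IsTubePoint K P q
  normalMap_eq : normalMap P q = y
  le_gradient : 13 / 16 * γ ≤ ‖∇ P q.1‖
  abs_mul_le : |q.2| * K ≤ 1 / 8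

namespace IsNearbyZeroSet

variable {k : ℕ} {K γ : ℝ} {f P : E → ℝ} {Y : Set E}

lemma const_pos (h : IsNearbyZeroSet k K γ f P Y) : 0 < K := h.pos.trans_le h.le_const

lemma differentiable (h : IsNearbyZeroSet k K γ f P Y) : Differentiable ℝ P :=
  h.contDiff.differentiable (by simp)

lemma subset_ball (h : IsNearbyZeroSet k K γ f P Y) : Y ⊆ ball 0 1 :=
  h.subset.trans (closedBall_subset_ball (by norm_num))

lemma closedBall_subset (h : IsNearbyZeroSet k K γ f P Y) {y : E} (hy : y ∈ Y) :
    closedBall y (γ / (16 * K)) ⊆ ball 0 1 := by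
  have hK := h.const_pos
  have : γ / (16 * K) ≤ 1 / 16 := by
    rw [div_le_div_iff₀ (by positivity) (by norm_num)]
    linarith [h.le_const]
  refine closedBall_subset_ball' ?_
  have := mem_closedBall.1 (h.subset hy)
  linarith

lemma contDiffAt (h : IsNearbyZeroSet k K γ f P Y) {x : E} (hx : x ∈ ball (0 : E) 1) :
    ContDiffAt ℝ k f x :=
  h.contDiffOn.contDiffAt (isOpen_ball.mem_nhds hx)

lemma differentiableAt (h : IsNearbyZeroSet k K γ f P Y) {x : E} (hx : x ∈ ball (0 : E) 1) :
    DifferentiableAt ℝ f x :=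
  (h.contDiffAt hx).differentiableAt (by exact_mod_cast h.ne_zero)

/-- Moving by `γ / (16 K)` along `±∇P(y)` changes the linear part of `P` by at least `7/128`, in
units of `γ² / K`. This beats the quadratic error `1/256` plus `|P y| ≤ 1/32`, so `P` changes sign
on the ball. -/
lemma exists_zero_near (h : IsNearbyZeroSet k K γ f P Y) {y : E} (hy : y ∈ Y) :
    ∃ w ∈ closedBall y (γ / (16 * K)), P w = 0 := by
  have hK := h.const_pos
  have hγ := h.pos
  set ρ := γ / (16 * K) with hρ
  have hρ0 : 0 < ρ := by positivity
  set N := ‖∇ P y‖ with hN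
  have hN0 : 0 < N := lt_of_lt_of_le (by positivity) (h.le_gradient y hy)
  set v : E := (ρ / N) • ∇ P y with hv
  have hvn : ‖v‖ = ρ := by
    rw [hv, norm_smul, Real.norm_of_nonneg (by positivity), ← hN]
    field_simp
  have hvi : ⟪∇ P y, v⟫ = ρ * N := by
    rw [hv, real_inner_smul_right, real_inner_self_eq_norm_sq, ← hN]
    field_simp
  have hp : y + v ∈ closedBall y ρ := by simp [hvn]
  have hm : y - v ∈ closedBall y ρ := by simp [hvn]
  have hsub := h.closedBall_subset hy
  have q1 := abs_le.1 (abs_sub_sub_inner_gradient_le hK.le (convex_ball _ _) h.differentiable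
    h.lipschitz (h.subset_ball hy) (hsub hp))
  have q2 := abs_le.1 (abs_sub_sub_inner_gradient_le hK.le (convex_ball _ _) h.differentiable
    h.lipschitz (h.subset_ball hy) (hsub hm))
  have e1 : y + v - y = v := by abel
  have e2 : y - v - y = -v := by abel
  rw [e1, hvn, hvi] at q1
  rw [e2, norm_neg, inner_neg_right, hvn, hvi] at q2
  have b1 := abs_le.1 (h.abs_apply_le y hy)
  have b2 := h.le_gradient y hy
  have c1 : ρ * N ≥ 7 / 128 * (γ ^ 2 / K) := by
    calc ρ * N ≥ ρ * (7 / 8 * γ) := by gcongr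
      _ = _ := by rw [hρ]; field_simp; norm_num
  have c2 : K * ρ ^ 2 = 1 / 256 * (γ ^ 2 / K) := by rw [hρ]; field_simp; norm_num
  have c3 : γ ^ 2 / (32 * K) = 1 / 32 * (γ ^ 2 / K) := by field_simp
  have c4 : 0 < γ ^ 2 / K := by positivity
  have := (convex_closedBall y ρ).isPreconnected.intermediate_value hm hp
    h.contDiff.continuous.continuousOn
  obtain ⟨w, hw, hw0⟩ := this (show (0 : ℝ) ∈ Icc (P (y - v)) (P (y + v)) by
    constructor <;> linarith)
  exact ⟨w, hw, hw0⟩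

/-- A nearest zero `w` of `P` exists because the zero set is closed in finite dimension, and
Lagrange multipliers make `y - w` parallel to `∇P(w)`. Over the distance `γ / (16 K)` the gradient
loses at most `γ / 16`, whence `7/8 - 1/16 = 13/16`. -/
lemma exists_foot (h : IsNearbyZeroSet k K γ f P Y) {y : E} (hy : y ∈ Y) :
    ∃ q, IsFoot K γ P y q ∧ ‖q.1 - y‖ ≤ 1 / 16 := by
  have hK := h.const_pos
  have hγ := h.pos
  obtain ⟨w₁, hw₁, hPw₁⟩ := h.exists_zero_near hy
  set ρ := γ / (16 * K) with hρ
  have hρ0 : 0 < ρ := by positivity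
  have hcl : IsClosed {x | P x = 0} := isClosed_eq h.contDiff.continuous continuous_const
  obtain ⟨w, hw, hwd⟩ := hcl.exists_infDist_eq_dist ⟨w₁, hPw₁⟩ y
  have hPw : P w = 0 := hw
  have hmin : ∀ x, P x = 0 → dist y w ≤ dist y x := fun x hx => hwd ▸ infDist_le_dist_of_mem hx
  have hwy : ‖w - y‖ ≤ ρ := by
    rw [← dist_eq_norm, dist_comm]
    exact (hmin _ hPw₁).trans (by rw [dist_comm]; exact hw₁)
  have hwU : w ∈ ball (0 : E) 1 := h.closedBall_subset hy (by rwa [mem_closedBall, dist_eq_norm])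
  have hgw : 13 / 16 * γ ≤ ‖∇ P w‖ := by
    have h1 := h.lipschitz y (h.subset_ball hy) w hwU
    have h2 := norm_le_norm_add_norm_sub' (∇ P y) (∇ P w)
    rw [norm_sub_rev] at h2
    have h3 : K * ‖w - y‖ ≤ K * ρ := by gcongr
    have h4 : K * ρ = γ / 16 := by rw [hρ]; field_simp
    linarith [h.le_gradient y hy]
  have hg0 : 0 < ‖∇ P w‖ := lt_of_lt_of_le (by positivity) hgw
  have hext : IsLocalExtrOn (fun x => ‖x - y‖ ^ 2) {x | P x = P w} w := by
    refine Or.inl (Filter.eventually_of_mem self_mem_nhdsWithin fun x hx => ?_)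
    have := hmin x (by rw [← hPw]; exact hx)
    rw [dist_comm, dist_comm y, dist_eq_norm, dist_eq_norm] at this
    simp only
    gcongr
  have hφ : HasStrictFDerivAt (fun x : E => ‖x - y‖ ^ 2) (2 • innerSL ℝ (w - y)) w := by
    have := (hasStrictFDerivAt_norm_sq (w - y)).comp w ((hasStrictFDerivAt_id w).sub_const y)
    exact this
  obtain ⟨a, b, hab, heq⟩ := hext.exists_multipliers_of_hasStrictFDerivAt_1d
    (h.contDiff.contDiffAt.hasStrictFDerivAt (by simp)) hφ
  have hvec : a • ∇ P w + (2 * b) • (w - y) = 0 := by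
    refine ext_inner_right ℝ fun v => ?_
    have := DFunLike.congr_fun heq v
    simp [inner_add_left, real_inner_smul_left] at this ⊢
    simp [inner_sub_left] at this ⊢
    linarith
  have hb : b ≠ 0 := by
    rintro rfl
    simp only [mul_zero, zero_smul, add_zero, smul_eq_zero] at hvec
    rcases hvec with rfl | h0
    · simp at hab
    · rw [h0, norm_zero] at hg0; exact lt_irrefl _ hg0
  have hys : (a / (2 * b)) • ∇ P w = y - w := by
    have h1 : a • ∇ P w = (2 * b) • (y - w) := by
      rw [← sub_eq_zero, ← hvec, ← neg_sub w y, smul_neg]; abel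
    rw [div_eq_inv_mul, mul_smul, h1, smul_smul, inv_mul_cancel₀ (by positivity), one_smul]
  -- The length `γ / (16 K)` divided by the gradient bound `13/16 γ`; the result is below the `1/8`
  -- required of a foot.
  have habs : |a / (2 * b)| * K ≤ 1 / 13 := by
    have h1 : |a / (2 * b)| * ‖∇ P w‖ ≤ ρ := by
      rw [← Real.norm_eq_abs, ← norm_smul, hys, norm_sub_rev]; exact hwy
    have h2 : |a / (2 * b)| * (13 / 16 * γ) ≤ γ / (16 * K) :=
      (mul_le_mul_of_nonneg_left hgw (abs_nonneg _)).trans h1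
    rw [le_div_iff₀ (by positivity)] at h2
    nlinarith
  refine ⟨(w, a / (2 * b)), ⟨⟨hwU, hPw, norm_pos_iff.1 hg0, by linarith⟩, ?_, hgw, by linarith⟩, ?_⟩
  · simp only [normalMap, hys]; abel
  · refine hwy.trans ?_
    rw [hρ, div_le_div_iff₀ (by positivity) (by norm_num)]
    linarith [h.le_const]

lemma eq_of_normalMap_eq (h : IsNearbyZeroSet k K γ f P Y) {q q' : E × ℝ}
    (hq : IsTubePoint K P q) (hq' : IsTubePoint K P q') (heq : normalMap P q = normalMap P q') :
    q = q' :=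
  hq.eq_of_normalMap_eq h.const_pos.le h.differentiable h.lipschitz hq' heq

/-- Along the normal at `w`, near the zero set, the gradient of `f` is close to `∇P(w)`. -/
lemma norm_gradient_sub_le (h : IsNearbyZeroSet k K γ f P Y) {w z : E} (hw : w ∈ ball (0 : E) 1)
    (hz : z ∈ ball (0 : E) 1) (hzw : ‖z - w‖ ≤ ‖∇ P w‖ / (8 * K)) :
    ‖∇ f z - ∇ P w‖ ≤ γ / 4 + ‖∇ P w‖ / 8 := by
  have hK := h.const_pos
  have h1 : K * ‖z - w‖ ≤ ‖∇ P w‖ / 8 := by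
    calc K * ‖z - w‖ ≤ K * (‖∇ P w‖ / (8 * K)) := by gcongr
      _ = _ := by field_simp
  calc ‖∇ f z - ∇ P w‖ ≤ ‖∇ f z - ∇ P z‖ + ‖∇ P z - ∇ P w‖ := norm_sub_le_norm_sub_add_norm_sub ..
    _ ≤ _ := add_le_add (h.gradient_close z hz) ((h.lipschitz w hw z hz).trans h1)

end IsNearbyZeroSet

lemma IsFoot.norm_sub_le {K γ : ℝ} {P : E → ℝ} {y : E} {q : E × ℝ} (hK : 0 < K)
    (hq : IsFoot K γ P y q) : ‖y - q.1‖ ≤ ‖∇ P q.1‖ / (8 * K) := by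
  rw [← hq.normalMap_eq, normalMap, add_sub_cancel_left, norm_smul, Real.norm_eq_abs,
    le_div_iff₀ (by positivity)]
  nlinarith [hq.abs_mul_le, norm_nonneg (∇ P q.1)]

namespace IsNearbyZeroSet

variable {k : ℕ} {K γ : ℝ} {f P : E → ℝ} {Y : Set E}

/-- On the segment from `y` to `y'`, which is parallel to `g = ∇P(w)`, the gradient of `f` is within
`γ / 4 + ‖g‖ / 8` of `g`. As `f` vanishes at both ends, the mean value inequality would give `‖g‖ ≤
γ / 4 + ‖g‖ / 8`, contradicting `‖g‖ ≥ 13/16 γ`. -/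
lemma eq_of_foot_eq (h : IsNearbyZeroSet k K γ f P Y) {y y' : E} (hy : y ∈ Y) (hy' : y' ∈ Y)
    {q q' : E × ℝ} (hq : IsFoot K γ P y q) (hq' : IsFoot K γ P y' q') (hqq' : q.1 = q'.1) :
    y = y' := by
  have hK := h.const_pos
  have hγ := h.pos
  by_contra hne
  have hpos : 0 < ‖y' - y‖ := norm_pos_iff.2 (sub_ne_zero.2 (Ne.symm hne))
  set w := q.1 with hw
  set g := ∇ P w with hg
  have hyc : y ∈ closedBall w (‖g‖ / (8 * K)) := by
    rw [mem_closedBall, dist_eq_norm]; exact hq.norm_sub_le hK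
  have hyc' : y' ∈ closedBall w (‖g‖ / (8 * K)) := by
    have := hq'.norm_sub_le hK
    rw [← hqq'] at this
    rw [mem_closedBall, dist_eq_norm]
    exact this
  have hmv : ‖f y' - f y - fderiv ℝ P w (y' - y)‖ ≤ (γ / 4 + ‖g‖ / 8) * ‖y' - y‖ := by
    refine (convex_segment y y').norm_image_sub_le_of_norm_fderiv_le' (fun z hz => ?_)
      (fun z hz => ?_) (left_mem_segment ℝ y y') (right_mem_segment ℝ y y')
    · exact h.differentiableAt ((convex_ball _ _).segment_subset (h.subset_ball hy)
        (h.subset_ball hy') hz)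
    · rw [norm_fderiv_sub_fderiv]
      refine h.norm_gradient_sub_le hq.tube.mem_ball ((convex_ball _ _).segment_subset
        (h.subset_ball hy) (h.subset_ball hy') hz) ?_
      rw [← dist_eq_norm]
      exact (convex_closedBall _ _).segment_subset hyc hyc' hz
  rw [(h.mem_iff y (h.subset_ball hy)).1 hy, (h.mem_iff y' (h.subset_ball hy')).1 hy',
    fderiv_eq_inner_gradient, sub_zero, zero_sub, norm_neg] at hmv
  have hdiff : y' - y = (q'.2 - q.2) • g := by
    rw [← hq.normalMap_eq, ← hq'.normalMap_eq, normalMap, normalMap, ← hqq', sub_smul]; abel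
  have hin : ‖⟪g, y' - y⟫‖ = ‖g‖ * ‖y' - y‖ := by
    rw [hdiff, real_inner_smul_right, real_inner_self_eq_norm_sq, norm_mul, norm_smul, norm_pow,
      norm_norm]
    ring
  rw [hin] at hmv
  have h1 := le_of_mul_le_mul_right hmv hpos
  have h2 : 13 / 16 * γ ≤ ‖g‖ := hq.le_gradient
  linarith

/-- Near the foot `w₀` of a point of `Y`, the normal at `w` meets the zero set of `f` at a parameter
`σ(w)` which depends smoothly on `w`. -/
lemma exists_normal_parameter (h : IsNearbyZeroSet k K γ f P Y) {y₀ : E} (hy₀ : y₀ ∈ Y)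
    {q₀ : E × ℝ} (hq₀ : IsFoot K γ P y₀ q₀) :
    ∃ σ : E → ℝ, ContDiffAt ℝ k σ q₀.1 ∧ σ q₀.1 = q₀.2 ∧
      ∀ᶠ w in 𝓝 q₀.1, f (normalMap P (w, σ w)) = 0 := by
  have hK := h.const_pos
  have hγ := h.pos
  have hk : ((k : ℕ) : WithTop ℕ∞) ≠ 0 := by exact_mod_cast h.ne_zero
  have hnm : ContDiffAt ℝ k (normalMap P) q₀ :=
    (contDiff_normalMap h.contDiff).contDiffAt.of_le le_top
  have hfy : ContDiffAt ℝ k f (normalMap P q₀) := by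
    rw [hq₀.normalMap_eq]; exact h.contDiffAt (h.subset_ball hy₀)
  have hF : ContDiffAt ℝ k (f ∘ normalMap P) q₀ := hfy.comp q₀ hnm
  have hder : (fderiv ℝ (f ∘ normalMap P) q₀ ∘L .inr ℝ E ℝ) 1 = ⟪∇ f y₀, ∇ P q₀.1⟫ := by
    have h1 : HasDerivAt (fun s : ℝ => normalMap P (q₀.1, s)) (∇ P q₀.1) q₀.2 := by
      simpa [normalMap] using ((hasDerivAt_id q₀.2).smul_const (∇ P q₀.1)).const_add q₀.1
    have h2 : HasDerivAt (fun s : ℝ => (q₀.1, s)) ((0 : E), (1 : ℝ)) q₀.2 :=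
      (hasDerivAt_const _ _).prodMk (hasDerivAt_id _)
    have h3 : HasDerivAt (fun s : ℝ => (f ∘ normalMap P) (q₀.1, s))
        (fderiv ℝ (f ∘ normalMap P) q₀ (0, 1)) q₀.2 :=
      HasFDerivAt.comp_hasDerivAt (f := fun s : ℝ => (q₀.1, s)) q₀.2
        (hF.differentiableAt hk).hasFDerivAt h2
    have h4 : HasDerivAt (fun s : ℝ => (f ∘ normalMap P) (q₀.1, s))
        (fderiv ℝ f (normalMap P q₀) (∇ P q₀.1)) q₀.2 :=
      HasFDerivAt.comp_hasDerivAt (f := fun s : ℝ => normalMap P (q₀.1, s)) q₀.2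
        (hfy.differentiableAt hk).hasFDerivAt h1
    have h5 := h3.unique h4
    rw [hq₀.normalMap_eq, fderiv_eq_inner_gradient] at h5
    exact h5
  -- Orthogonality would give `‖∇P(w₀)‖ ≤ ‖∇f(y₀) - ∇P(w₀)‖`, against the same gradient estimate:
  -- the zero set of `f` is transverse to the normal.
  have hpos : ⟪∇ f y₀, ∇ P q₀.1⟫ ≠ 0 := by
    have h1 := h.norm_gradient_sub_le hq₀.tube.mem_ball (h.subset_ball hy₀) (hq₀.norm_sub_le hK)
    have h2 := hq₀.le_gradient
    have h3 : 0 < ‖∇ P q₀.1‖ := norm_pos_iff.2 hq₀.tube.gradient_ne_zero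
    intro h0
    have h4 := real_inner_le_norm (∇ P q₀.1 - ∇ f y₀) (∇ P q₀.1)
    rw [inner_sub_left, h0, sub_zero, real_inner_self_eq_norm_sq, norm_sub_rev, pow_two] at h4
    have h5 := le_of_mul_le_mul_right h4 h3
    linarith
  have hinv : (fderiv ℝ (f ∘ normalMap P) q₀ ∘L .inr ℝ E ℝ).IsInvertible := by
    refine ⟨ContinuousLinearEquiv.unitsEquivAut ℝ (Units.mk0 _ hpos), ?_⟩
    ext
    rw [hder]
    simp
  refine ⟨hF.implicitFunction hk hinv, hF.contDiffAt_implicitFunction hk hinv,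
    hF.implicitFunction_apply_self hk hinv, ?_⟩
  filter_upwards [hF.eventually_apply_implicitFunction hk hinv] with w hw
  rw [Function.comp_apply, Function.comp_apply, hq₀.normalMap_eq,
    (h.mem_iff y₀ (h.subset_ball hy₀)).1 hy₀] at hw
  exact hw

lemma tubePoint_of_foot (h : IsNearbyZeroSet k K γ f P Y) {y : E} {q : E × ℝ}
    (hq : IsFoot K γ P y q) {t : ℝ} (ht : t ∈ Icc (0 : ℝ) 1) : IsTubePoint K P (q.1, t * q.2) := by
  refine ⟨hq.tube.mem_ball, hq.tube.eq_zero, hq.tube.gradient_ne_zero, ?_⟩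
  simp only [abs_mul, abs_of_nonneg ht.1]
  have := hq.abs_mul_le
  have h2 : 0 ≤ |q.2| * K := mul_nonneg (abs_nonneg _) h.const_pos.le
  nlinarith [ht.2]

/-- Near a point `z₀` of the normal segment from `w₀` to `y₀ ∈ Y`, moving to `Y` along the normals
of the zero set of `P` is a smooth map. -/
lemma exists_local_section (h : IsNearbyZeroSet k K γ f P Y) {y₀ : E} (hy₀ : y₀ ∈ Y)
    {q₀ : E × ℝ} (hq₀ : IsFoot K γ P y₀ q₀) {t : ℝ} (ht : t ∈ Icc (0 : ℝ) 1) :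
    ∃ ρ : E → E, ContDiffAt ℝ k ρ (normalMap P (q₀.1, t * q₀.2)) ∧
      ∀ᶠ z in 𝓝 (normalMap P (q₀.1, t * q₀.2)), ρ z ∈ Y ∧ ∃ q, IsFoot K γ P (ρ z) q ∧
        ∃ τ : ℝ, IsTubePoint K P (q.1, τ) ∧ normalMap P (q.1, τ) = z := by
  have hK := h.const_pos
  set z₀ := normalMap P (q₀.1, t * q₀.2) with hz₀
  have hT := h.tubePoint_of_foot hq₀ ht
  obtain ⟨r, hr, hr0, hrz⟩ := hT.exists_local_inverse hK.le h.contDiff h.lipschitz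
  obtain ⟨σ, hσ, hσ0, hσf⟩ := h.exists_normal_parameter hy₀ hq₀
  have hr1 : ContDiffAt ℝ k (fun z => (r z).1) z₀ :=
    (contDiff_fst.contDiffAt.comp z₀ hr).of_le le_top
  have hr10 : (r z₀).1 = q₀.1 := by rw [hr0]
  have hσr : ContDiffAt ℝ k (fun z => σ (r z).1) z₀ :=
    ContDiffAt.comp z₀ (g := σ) (by simpa only [hr10] using hσ) hr1
  have hp : ContDiffAt ℝ k (fun z => ((r z).1, σ (r z).1)) z₀ := hr1.prodMk hσr
  have hp0 : ((r z₀).1, σ (r z₀).1) = q₀ := by rw [hr10, hσ0]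
  have hρ : ContDiffAt ℝ k (fun z => normalMap P ((r z).1, σ (r z).1)) z₀ :=
    ((contDiff_normalMap h.contDiff).contDiffAt.of_le le_top).comp z₀ hp
  -- The section takes the base point of `z` in the tube and moves along the normal there to the
  -- parameter `σ`.
  refine ⟨_, hρ, ?_⟩
  have e1 : ∀ᶠ z in 𝓝 z₀, f (normalMap P ((r z).1, σ (r z).1)) = 0 :=
    hr1.continuousAt.eventually (by simpa only [hr10] using hσf)
  have e2 : ∀ᶠ z in 𝓝 z₀, normalMap P ((r z).1, σ (r z).1) ∈ ball (0 : E) 1 := by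
    refine hρ.continuousAt.eventually_mem (isOpen_ball.mem_nhds ?_)
    rw [hp0, hq₀.normalMap_eq]
    exact h.subset_ball hy₀
  have e3 : ∀ᶠ z in 𝓝 z₀, P (r z).1 = 0 → IsTubePoint K P ((r z).1, σ (r z).1) :=
    hp.continuousAt.eventually (by simpa only [hp0] using hq₀.tube.eventually h.contDiff)
  filter_upwards [e1, e2, e3, hrz] with z e1 e2 e3 e4
  have hY := (h.mem_iff _ e2).2 e1
  -- By injectivity of the normal map, the foot of `ρ z` is the base point of `z`.
  obtain ⟨q, hq, -⟩ := h.exists_foot hY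
  have hqe := h.eq_of_normalMap_eq hq.tube (e3 e4.1.eq_zero) hq.normalMap_eq
  refine ⟨hY, q, hq, (r z).2, ?_⟩
  rw [hqe]
  exact e4

/-- Injectivity of the normal map identifies any foot with the value of the local inverse, so the
foot map, meaningful only on `Y`, extends smoothly near each point of `Y`. -/
lemma exists_local_foot (h : IsNearbyZeroSet k K γ f P Y) {y₀ : E} {q₀ : E × ℝ}
    (hq₀ : IsFoot K γ P y₀ q₀) :
    ∃ r : E → E × ℝ, ContDiffAt ℝ k r y₀ ∧ ∀ᶠ y in 𝓝 y₀, ∀ q, IsFoot K γ P y q → q = r y := by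
  obtain ⟨r, hr, hr0, hrz⟩ := hq₀.tube.exists_local_inverse h.const_pos.le h.contDiff h.lipschitz
  rw [hq₀.normalMap_eq] at hr hr0 hrz
  refine ⟨r, hr.of_le le_top, ?_⟩
  filter_upwards [hrz] with y hy q hq
  exact h.eq_of_normalMap_eq hq.tube hy.1 (hq.normalMap_eq.trans hy.2.symm)

end IsNearbyZeroSet

end NearbyZeroSets

/-! ### Connected components -/

section Components

lemma sUnion_components {X : Type*} [TopologicalSpace X] (S : Set X) : ⋃₀ components S = S := by
  refine subset_antisymm (sUnion_subset ?_) fun x hx =>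
    ⟨_, ⟨x, hx, rfl⟩, mem_connectedComponentIn hx⟩
  rintro C ⟨x, -, rfl⟩
  exact connectedComponentIn_subset S x

/-- A compact set which is locally a retract of the ambient space has finitely many components. -/
lemma finite_components_of_local_retract {E : Type*} [NormedAddCommGroup E] [NormedSpace ℝ E]
    {S : Set E} (hS : IsCompact S)
    (hr : ∀ x ∈ S, ∃ U ∈ 𝓝 x, ∃ r : E → E, ContinuousOn r U ∧ MapsTo r U S ∧
      ∀ y ∈ U, y ∈ S → r y = y) : (components S).Finite := by
  have key : ∀ x ∈ S, ∃ B ∈ 𝓝 x, B ∩ S ⊆ connectedComponentIn S x := by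
    intro x hx
    obtain ⟨U, hU, r, hrc, hrm, hrid⟩ := hr x hx
    obtain ⟨ε, hε, hεU⟩ := Metric.mem_nhds_iff.1 hU
    refine ⟨ball x ε, ball_mem_nhds x hε, fun y hy => ?_⟩
    -- The ball is connected, so its image under `r` is a connected subset of `S` containing all of
    -- `S` in the ball: components are open in `S`.
    have hpre : IsPreconnected (r '' ball x ε) :=
      (convex_ball x ε).isPreconnected.image r (hrc.mono hεU)
    have hsub := hpre.subset_connectedComponentIn (F := S)
      ⟨x, mem_ball_self hε, hrid x (hεU (mem_ball_self hε)) hx⟩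
      (image_subset_iff.2 fun z hz => hrm (hεU hz))
    exact hsub ⟨y, hy.1, hrid y (hεU hy.1) hy.2⟩
  choose! B hB hBS using key
  obtain ⟨t, htS, ht⟩ := hS.elim_nhds_subcover B hB
  refine (t.finite_toSet.image (connectedComponentIn S)).subset ?_
  rintro C ⟨y, hy, rfl⟩
  obtain ⟨x, hx, hyx⟩ := mem_iUnion₂.1 (ht hy)
  exact ⟨x, hx, connectedComponentIn_eq (hBS x (htS x hx) ⟨hyx, hy⟩)⟩

/-- A homeomorphism onto a clopen subset of `Z` maps components to components of `Z`. -/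
lemma image_connectedComponentIn_eq {X : Type*} [TopologicalSpace X] {Y Z : Set X} {p g : X → X}
    (hp : ContinuousOn p Y) (hg : ContinuousOn g (p '' Y)) (hgp : ∀ x ∈ Y, g (p x) = x)
    (hcl : IsClosed (p '' Y)) (hsub : p '' Y ⊆ Z)
    (hop : ∀ w ∈ p '' Y, ∀ᶠ z in 𝓝 w, z ∈ Z → z ∈ p '' Y) {x : X} (hx : x ∈ Y) :
    p '' connectedComponentIn Y x = connectedComponentIn Z (p x) := by
  have hYx := connectedComponentIn_subset Y x
  refine subset_antisymm ?_ ?_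
  · exact (isPreconnected_connectedComponentIn.image p (hp.mono hYx)).subset_connectedComponentIn
      (mem_image_of_mem p (mem_connectedComponentIn hx)) ((image_mono hYx).trans hsub)
  · have hpx : p x ∈ Z := hsub (mem_image_of_mem p hx)
    set C := connectedComponentIn Z (p x) with hC
    have hCZ : C ⊆ Z := connectedComponentIn_subset _ _
    have hCW : C ⊆ p '' Y := by
      by_contra hne
      obtain ⟨z, hzC, hzW⟩ := not_subset.1 hne
      -- Otherwise `O` and the complement of `p '' Y` would separate the connected set `C`: they
      -- cover it and are disjoint inside `Z`.
      set O := interior {z | z ∈ Z → z ∈ p '' Y} with hO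
      have hWO : p '' Y ⊆ O := fun w hw => mem_interior_iff_mem_nhds.2 (hop w hw)
      have hcon : IsPreconnected C := isPreconnected_connectedComponentIn
      obtain ⟨u, huC, huO, huW⟩ := hcon O (p '' Y)ᶜ isOpen_interior hcl.isOpen_compl
        (fun u _ => by
          by_cases hu : u ∈ p '' Y
          · exact Or.inl (hWO hu)
          · exact Or.inr hu)
        ⟨p x, mem_connectedComponentIn hpx, hWO (mem_image_of_mem p hx)⟩ ⟨z, hzC, hzW⟩
      exact huW (interior_subset huO (hCZ huC))
    have hgC : g '' C ⊆ connectedComponentIn Y x := by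
      refine (isPreconnected_connectedComponentIn.image g
        (hg.mono hCW)).subset_connectedComponentIn
        ⟨p x, mem_connectedComponentIn hpx, hgp x hx⟩ ?_
      rintro _ ⟨z, hz, rfl⟩
      obtain ⟨y, hy, rfl⟩ := hCW hz
      rwa [hgp y hy]
    intro z hz
    obtain ⟨y, hy, rfl⟩ := hCW hz
    exact mem_image_of_mem p (by simpa [hgp y hy] using hgC (mem_image_of_mem g hz))

end Components

/-! ### Smooth maps on arbitrary subsets -/

section Smooth

variable {E F : Type*} [NormedAddCommGroup E] [NormedSpace ℝ E] [NormedAddCommGroup F]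
  [NormedSpace ℝ F]

/-- For finite `k`, being `C^k` at a point is an open condition, so pointwise extensions suffice. -/
lemma isCkOn_of_contDiffAt {k : ℕ} {h : E → F} {S : Set E}
    (H : ∀ x ∈ S, ∃ g : E → F, ContDiffAt ℝ k g x ∧ ∀ᶠ y in 𝓝 x, y ∈ S → h y = g y) :
    IsCkOn k h S := by
  intro x hx
  obtain ⟨g, hg, he⟩ := H x hx
  obtain ⟨U, hU, hUo, hxU⟩ := _root_.eventually_nhds_iff.1 ((hg.eventually (by simp)).and he)
  exact ⟨U, hUo, hxU, g, fun y hy => (hU y hy).1.contDiffWithinAt, fun y hy => (hU y hy.2).2 hy.1⟩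

lemma IsCkOn.continuousOn {k : WithTop ℕ∞} {h : E → F} {S : Set E} (hh : IsCkOn k h S) :
    ContinuousOn h S := by
  intro x hx
  obtain ⟨U, hU, hxU, g, hg, he⟩ := hh x hx
  have h1 : ContinuousWithinAt g (S ∩ U) x := (hg.continuousOn x hxU).mono inter_subset_right
  have h2 : ContinuousWithinAt h (S ∩ U) x := h1.congr he (he ⟨hx, hxU⟩)
  exact (continuousWithinAt_inter (hU.mem_nhds hxU)).1 h2

end Smooth

/-! ### The isotopy along the normals -/

namespace IsNearbyZeroSet

variable {E : Type*} [NormedAddCommGroup E] [InnerProductSpace ℝ E] [FiniteDimensional ℝ E]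
  {k : ℕ} {K γ : ℝ} {f P : E → ℝ} {Y : Set E}

lemma isCompact (h : IsNearbyZeroSet k K γ f P Y) : IsCompact Y := by
  have hsub : closedBall (0 : E) (1 / 2) ⊆ ball 0 1 := closedBall_subset_ball (by norm_num)
  have hcont : ContinuousOn f (closedBall 0 (1 / 2)) := h.contDiffOn.continuousOn.mono hsub
  have hY : Y = closedBall 0 (1 / 2) ∩ f ⁻¹' {0} := by
    ext x
    refine ⟨fun hx => ⟨h.subset hx, (h.mem_iff x (h.subset_ball hx)).1 hx⟩, fun hx => ?_⟩
    exact (h.mem_iff x (hsub hx.1)).2 hx.2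
  rw [hY]
  exact (isCompact_closedBall 0 (1 / 2)).of_isClosed_subset
    (hcont.preimage_isClosed_of_isClosed isClosed_closedBall isClosed_singleton) inter_subset_left

/-- The zero set of `f` is isotopic to a union of smooth components of the zero set of `P`. -/
theorem exists_isotopy (h : IsNearbyZeroSet k K γ f P Y) :
    ∃ (q : ℕ) (V W : Fin q → Set E), Function.Injective V ∧ range V = components Y ∧
      Function.Injective W ∧ (∀ i, W i ∈ components {x | P x = 0}) ∧
      (∀ i, ∀ x ∈ W i, ∇ P x ≠ 0) ∧ IsotopicIn k (closedBall 0 1) Y (⋃ i, W i) := by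
  choose! F hF hFy using fun y (hy : y ∈ Y) => h.exists_foot hy
  have hFu : ∀ y ∈ Y, ∀ q, IsFoot K γ P y q → q = F y := fun y hy q hq =>
    h.eq_of_normalMap_eq hq.tube (hF y hy).tube (hq.normalMap_eq.trans (hF y hy).normalMap_eq.symm)
  set p : E → E := fun y => (F y).1 with hp
  -- The straight motion from `y` to its foot stays on the normal and multiplies the normal
  -- parameter by `1 - τ`.
  let H : E × ℝ → E := fun a => a.2 • p a.1 + (1 - a.2) • a.1
  have hH : ∀ y ∈ Y, ∀ τ, H (y, τ) = normalMap P ((F y).1, (1 - τ) * (F y).2) := by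
    intro y hy τ
    have := (hF y hy).normalMap_eq
    simp only [H, hp]
    nth_rw 2 [← this]
    simp only [normalMap, smul_add, mul_smul]
    module
  have hH0 : ∀ y, H (y, 0) = y := fun y => by simp [H]
  have hH1 : ∀ y, H (y, 1) = p y := fun y => by simp [H]
  -- These local sections have three uses: at any `τ` they extend the inverse of `H(·, τ)`; at `τ =
  -- 0` they retract onto `Y`, giving finitely many components; at `τ = 1` they show that `p '' Y`
  -- is open in the zero set of `P`.
  have hsec : ∀ y₀ ∈ Y, ∀ τ ∈ Icc (0 : ℝ) 1, ∃ ρ : E → E, ContDiffAt ℝ k ρ (H (y₀, τ)) ∧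
      ∀ᶠ z in 𝓝 (H (y₀, τ)), ρ z ∈ Y ∧
        (∃ t : ℝ, IsTubePoint K P (p (ρ z), t) ∧ normalMap P (p (ρ z), t) = z) ∧
        ∀ y ∈ Y, H (y, τ) = z → ρ z = y := by
    intro y₀ hy₀ τ hτ
    have hτ' : 1 - τ ∈ Icc (0 : ℝ) 1 := ⟨by linarith [hτ.2], by linarith [hτ.1]⟩
    obtain ⟨ρ, hρ, hρz⟩ := h.exists_local_section hy₀ (hF y₀ hy₀) hτ'
    rw [← hH y₀ hy₀] at hρ hρz
    refine ⟨ρ, hρ, ?_⟩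
    filter_upwards [hρz] with z hz
    obtain ⟨hzY, q, hq, t, ht, htz⟩ := hz
    rw [hFu _ hzY q hq] at ht htz
    refine ⟨hzY, ⟨t, ht, htz⟩, fun y hy hyz => ?_⟩
    have h1 := h.eq_of_normalMap_eq ht (h.tubePoint_of_foot (hF y hy) hτ')
      (by rw [htz, ← hyz, hH y hy])
    have h2 : (F (ρ z)).1 = (F y).1 := (Prod.mk.inj h1).1
    exact h.eq_of_foot_eq hzY hy (hF _ hzY) (hF y hy) h2
  have hinj : ∀ τ ∈ Icc (0 : ℝ) 1, InjOn (fun y => H (y, τ)) Y := by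
    intro τ hτ y hy y' hy' heq
    obtain ⟨ρ, -, hρ⟩ := hsec y hy τ hτ
    have hρ0 := hρ.self_of_nhds.2.2
    rw [← hρ0 y hy rfl]
    exact hρ0 y' hy' heq.symm
  have hpC : ∀ y₀ ∈ Y, ∃ r : E → E, ContDiffAt ℝ k r y₀ ∧ ∀ᶠ y in 𝓝 y₀, y ∈ Y → p y = r y := by
    intro y₀ hy₀
    obtain ⟨r, hr, hrz⟩ := h.exists_local_foot (hF y₀ hy₀)
    refine ⟨fun y => (r y).1, contDiff_fst.contDiffAt.comp y₀ hr, ?_⟩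
    filter_upwards [hrz] with y hy hyY
    rw [← hy _ (hF y hyY)]
  have hHC : IsCkOn k H (Y ×ˢ Icc (0 : ℝ) 1) := by
    refine isCkOn_of_contDiffAt ?_
    rintro ⟨y₀, τ₀⟩ ⟨hy₀, -⟩
    obtain ⟨r, hr, hrz⟩ := hpC y₀ hy₀
    refine ⟨fun a => a.2 • r a.1 + (1 - a.2) • a.1, ?_, ?_⟩
    · have h1 : ContDiffAt ℝ k (fun a : E × ℝ => r a.1) (y₀, τ₀) :=
        ContDiffAt.comp (y₀, τ₀) (g := r) hr contDiffAt_fst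
      exact (contDiffAt_snd.smul h1).add ((contDiffAt_const.sub contDiffAt_snd).smul contDiffAt_fst)
    · have hfst : Tendsto Prod.fst (𝓝 (y₀, τ₀)) (𝓝 y₀) := continuous_fst.continuousAt
      filter_upwards [hfst.eventually hrz] with a ha haY
      simp only [H, ha haY.1]
  have hdiffeo : ∀ τ ∈ Icc (0 : ℝ) 1, IsCkDiffeoOntoImage k (fun y => H (y, τ)) Y := by
    intro τ hτ
    refine ⟨isCkOn_of_contDiffAt fun y₀ hy₀ => ?_, Function.invFunOn (fun y => H (y, τ)) Y,
      isCkOn_of_contDiffAt ?_, (hinj τ hτ).leftInvOn_invFunOn⟩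
    · obtain ⟨r, hr, hrz⟩ := hpC y₀ hy₀
      refine ⟨fun y => τ • r y + (1 - τ) • y,
        (contDiffAt_const.smul hr).add (contDiffAt_const.smul contDiffAt_id), ?_⟩
      filter_upwards [hrz] with y hy hyY
      simp only [H, hy hyY]
    · rintro _ ⟨y₀, hy₀, rfl⟩
      obtain ⟨ρ, hρ, hρz⟩ := hsec y₀ hy₀ τ hτ
      refine ⟨ρ, hρ, ?_⟩
      filter_upwards [hρz] with z hz
      rintro ⟨y, hy, rfl⟩
      rw [hz.2.2 y hy rfl]
      exact (hinj τ hτ).leftInvOn_invFunOn hy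
  have hmem : ∀ y ∈ Y, ∀ τ ∈ Icc (0 : ℝ) 1, H (y, τ) ∈ closedBall (0 : E) 1 := fun y hy τ hτ =>
    ball_subset_closedBall ((convex_ball (0 : E) 1) (hF y hy).tube.mem_ball (h.subset_ball hy)
      hτ.1 (by linarith [hτ.2]) (by ring))
  have hpcont : ContinuousOn p Y := (isCkOn_of_contDiffAt hpC).continuousOn
  obtain ⟨-, g, hg, hgp⟩ := hdiffeo 1 ⟨zero_le_one, le_rfl⟩
  simp only [hH1] at hg hgp
  have hop : ∀ w ∈ p '' Y, ∀ᶠ z in 𝓝 w, z ∈ {x | P x = 0} → z ∈ p '' Y := by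
    rintro _ ⟨y₀, hy₀, rfl⟩
    obtain ⟨ρ, -, hρ⟩ := hsec y₀ hy₀ 1 ⟨zero_le_one, le_rfl⟩
    rw [hH1] at hρ
    have htube : IsTubePoint K P (p y₀, 0) := by
      simpa using h.tubePoint_of_foot (hF y₀ hy₀) (t := 0) ⟨le_rfl, zero_le_one⟩
    have hev : ∀ᶠ z in 𝓝 (p y₀), P z = 0 → IsTubePoint K P (z, 0) :=
      (Continuous.prodMk_left (0 : ℝ)).continuousAt.eventually (htube.eventually h.contDiff)
    filter_upwards [hρ, hev] with z hz hz' hPz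
    obtain ⟨hzY, ⟨t, ht, htz⟩, -⟩ := hz
    -- A zero `z` of `P` is its own base point, with parameter `0`; hence `z = p (ρ z)`.
    have := h.eq_of_normalMap_eq ht (hz' hPz) (by rw [htz]; simp [normalMap])
    exact ⟨ρ z, hzY, (Prod.mk.inj this).1⟩
  have hcomp : ∀ x ∈ Y, p '' connectedComponentIn Y x = connectedComponentIn {x | P x = 0} (p x) :=
    fun x hx => image_connectedComponentIn_eq hpcont hg.continuousOn hgp
      (h.isCompact.image_of_continuousOn hpcont).isClosed
      (by rintro _ ⟨y, hy, rfl⟩; exact (hF y hy).tube.eq_zero) hop hx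
  have hfin : (components Y).Finite := by
    refine finite_components_of_local_retract h.isCompact fun y₀ hy₀ => ?_
    obtain ⟨ρ, hρ, hρz⟩ := hsec y₀ hy₀ 0 ⟨le_rfl, zero_le_one⟩
    rw [hH0] at hρ hρz
    refine ⟨_, (hρ.eventually (by simp)).and hρz, ρ,
      fun z hz => hz.1.continuousAt.continuousWithinAt, fun z hz => hz.2.1, fun z hz hzY => ?_⟩
    exact hz.2.2.2 z hzY (hH0 z)
  obtain ⟨q, V, hVinj, hV⟩ := hfin.fin_param
  have hVm : ∀ i, V i ∈ components Y := fun i => hV ▸ mem_range_self i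
  have hVY : ∀ i, V i ⊆ Y := fun i => by
    obtain ⟨x, -, hx⟩ := hVm i
    exact hx ▸ connectedComponentIn_subset Y x
  have hpinj : InjOn p Y := fun y hy y' hy' heq => by rw [← hgp y hy, ← hgp y' hy', heq]
  refine ⟨q, V, fun i => p '' V i, hVinj, hV, fun i j hij => hVinj ?_, fun i => ?_, ?_, ?_⟩
  · exact (hpinj.image_eq_image_iff (hVY i) (hVY j)).1 hij
  · obtain ⟨x, hx, hxV⟩ := hVm i
    refine ⟨p x, (hF x hx).tube.eq_zero, ?_⟩
    simp only [hxV, hcomp x hx]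
  · rintro i _ ⟨y, hy, rfl⟩
    exact (hF y (hVY i hy)).tube.gradient_ne_zero
  · refine ⟨H, hHC, hmem, hdiffeo, fun y _ => hH0 y, ?_⟩
    simp only [hH1]
    rw [← image_iUnion, ← sUnion_range, hV, sUnion_components]

end IsNearbyZeroSet

/-! ### Symmetry of higher derivatives and Taylor estimates -/

section IteratedDerivative

variable {E F : Type*} [NormedAddCommGroup E] [NormedSpace ℝ E] [NormedAddCommGroup F]
  [NormedSpace ℝ F]

/-- Splits off the two outermost differentiations, so that the symmetry of second derivatives can
act on the first two slots. -/
lemma iteratedFDeriv_add_two_apply {n : ℕ} {f : E → F} {x : E}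
    (hf : ContDiffAt ℝ (n + 2 : ℕ) f x) (v : Fin (n + 2) → E) :
    iteratedFDeriv ℝ (n + 2) f x v =
      fderiv ℝ (fderiv ℝ (iteratedFDeriv ℝ n f)) x (v 0) (v 1) (Fin.tail (Fin.tail v)) := by
  have hd : DifferentiableAt ℝ (iteratedFDeriv ℝ (n + 1) f) x :=
    hf.differentiableAt_iteratedFDeriv (by exact_mod_cast Nat.lt_succ_self _)
  have hg : ContDiffAt ℝ (1 + 1) (iteratedFDeriv ℝ n f) x :=
    hf.iteratedFDeriv_right (by push_cast; rw [add_comm (n : WithTop ℕ∞)]; norm_num)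
  have hg' : DifferentiableAt ℝ (fderiv ℝ (iteratedFDeriv ℝ n f)) x :=
    (hg.fderiv_right le_rfl).differentiableAt one_ne_zero
  rw [hd.iteratedFDeriv_succ_apply_left']
  have h1 : HasFDerivAt (fun y => fderiv ℝ (iteratedFDeriv ℝ n f) y (v 1))
      ((fderiv ℝ (fderiv ℝ (iteratedFDeriv ℝ n f)) x).flip (v 1)) x := by
    simpa using! hg'.hasFDerivAt.clm_apply (hasFDerivAt_const (v 1) x)
  have h2 := fderiv_continuousMultilinear_apply_const h1.differentiableAt (Fin.tail (Fin.tail v))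
  rw [h1.fderiv] at h2
  have h3 := DFunLike.congr_fun h2 (v 0)
  exact h3

/-- Swapping the first two slots is the symmetry of the second derivative of the `n`-th derivative.
Any later adjacent swap holds one order lower near `x`, and differentiating that identity gives it
here. -/
lemma iteratedFDeriv_comp_swap {n : ℕ} {f : E → F} {x : E} (hf : ContDiffAt ℝ (n + 1 : ℕ) f x)
    (i : Fin n) (v : Fin (n + 1) → E) :
    iteratedFDeriv ℝ (n + 1) f x (v ∘ Equiv.swap i.castSucc i.succ) =
      iteratedFDeriv ℝ (n + 1) f x v := by
  induction n generalizing x with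
  | zero => exact i.elim0
  | succ n ih =>
    refine Fin.cases ?_ (fun j => ?_) i
    · rw [iteratedFDeriv_add_two_apply hf, iteratedFDeriv_add_two_apply hf]
      have hg : ContDiffAt ℝ 2 (iteratedFDeriv ℝ n f) x :=
        hf.iteratedFDeriv_right (by push_cast; rw [add_comm (2 : WithTop ℕ∞), add_assoc]; norm_num)
      have hs := hg.isSymmSndFDerivAt (by simp)
      have e0 : (v ∘ Equiv.swap (Fin.castSucc 0) (Fin.succ 0)) 0 = v 1 := by
        simp
      have e1 : (v ∘ Equiv.swap (Fin.castSucc 0) (Fin.succ 0)) 1 = v 0 := by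
        simp
      have e2 : Fin.tail (Fin.tail (v ∘ Equiv.swap (Fin.castSucc 0) (Fin.succ 0))) =
          Fin.tail (Fin.tail v) := by
        funext k
        simp only [Fin.tail, Function.comp_apply]
        rw [Equiv.swap_apply_of_ne_of_ne]
        · exact Fin.succ_ne_zero _
        · exact fun h => Fin.succ_ne_zero k (Fin.succ_injective _ h)
      rw [e0, e1, e2, hs]
    · have hd : DifferentiableAt ℝ (iteratedFDeriv ℝ (n + 1) f) x :=
        hf.differentiableAt_iteratedFDeriv (by exact_mod_cast Nat.lt_succ_self _)
      rw [hd.iteratedFDeriv_succ_apply_left', hd.iteratedFDeriv_succ_apply_left']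
      have e0 : (v ∘ Equiv.swap j.succ.castSucc j.succ.succ) 0 = v 0 := by
        simp only [Function.comp_apply]
        rw [Equiv.swap_apply_of_ne_of_ne]
        · rw [Fin.castSucc_succ]; exact (Fin.succ_ne_zero _).symm
        · exact (Fin.succ_ne_zero _).symm
      have e1 : Fin.tail (v ∘ Equiv.swap j.succ.castSucc j.succ.succ) =
          Fin.tail v ∘ Equiv.swap j.castSucc j.succ := by
        funext k
        simp only [Fin.tail, Function.comp_apply]
        rw [Fin.castSucc_succ, (Fin.succ_injective _).swap_apply]
      have hev : (fun y => iteratedFDeriv ℝ (n + 1) f y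
          (Fin.tail v ∘ Equiv.swap j.castSucc j.succ)) =ᶠ[𝓝 x]
          fun y => iteratedFDeriv ℝ (n + 1) f y (Fin.tail v) := by
        filter_upwards [hf.eventually (by simp)] with y hy
        exact ih (hy.of_le (by exact_mod_cast Nat.le_succ _)) j (Fin.tail v)
      rw [e0, e1, hev.fderiv_eq]

/-- The `n`-th derivative of a `C^n` function is symmetric. -/
theorem iteratedFDeriv_comp_perm_of_contDiffAt {n : ℕ} {f : E → F} {x : E}
    (hf : ContDiffAt ℝ n f x) (v : Fin n → E) (σ : Equiv.Perm (Fin n)) :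
    iteratedFDeriv ℝ n f x (v ∘ σ) = iteratedFDeriv ℝ n f x v := by
  cases n with
  | zero => rw [Subsingleton.elim (v ∘ σ) v]
  | succ n =>
    -- Adjacent transpositions generate the symmetric group.
    have hσ : σ ∈ Submonoid.closure (range fun i : Fin n => Equiv.swap i.castSucc i.succ) := by
      rw [Equiv.Perm.mclosure_swap_castSucc_succ]; exact Submonoid.mem_top _
    induction hσ using Submonoid.closure_induction generalizing v with
    | mem τ hτ =>
      obtain ⟨i, rfl⟩ := hτ
      exact iteratedFDeriv_comp_swap hf i v
    | one => rfl
    | mul σ τ _ _ h1 h2 =>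
      rw [Equiv.Perm.coe_mul, ← Function.comp_assoc, h2, h1]

/-- Taylor estimates for the derivatives of a function which vanishes to order `d` at the origin. -/
theorem norm_iteratedFDeriv_le_of_vanishing {d : ℕ} {R : E → F} {ε : ℝ} {U : Set E}
    (hU : IsOpen U) (hU0 : StarConvex ℝ 0 U) (hR : ContDiffOn ℝ (d + 1 : ℕ) R U)
    (h0 : ∀ j ≤ d, iteratedFDeriv ℝ j R 0 = 0)
    (hε : ∀ x ∈ U, ‖iteratedFDeriv ℝ (d + 1) R x‖ ≤ ε) {m j : ℕ} (hjm : j + m = d + 1)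
    {x : E} (hx : x ∈ U) : ‖iteratedFDeriv ℝ j R x‖ ≤ ε * ‖x‖ ^ m / m ! := by
  induction m generalizing j x with
  | zero =>
    obtain rfl : j = d + 1 := hjm
    simpa using hε x hx
  | succ m ih =>
    have hmem : ∀ t ∈ Icc (0 : ℝ) 1, t • x ∈ U := fun t ht => hU0.smul_mem hx ht.1 ht.2
    have hder : ∀ t ∈ Icc (0 : ℝ) 1, HasDerivAt (fun t : ℝ => iteratedFDeriv ℝ j R (t • x))
        (fderiv ℝ (iteratedFDeriv ℝ j R) (t • x) x) t := by
      intro t ht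
      have hc : ContDiffAt ℝ (d + 1 : ℕ) R (t • x) := hR.contDiffAt (hU.mem_nhds (hmem t ht))
      have h1 : HasDerivAt (fun t : ℝ => t • x) x t := by
        simpa using (hasDerivAt_id t).smul_const x
      have h2 : DifferentiableAt ℝ (iteratedFDeriv ℝ j R) (t • x) :=
        hc.differentiableAt_iteratedFDeriv (by exact_mod_cast (by omega : j < d + 1))
      exact h2.hasFDerivAt.comp_hasDerivAt t h1
    -- The primitive of the bound for order `j + 1` along the ray `t ↦ t • x`; comparison starts
    -- from `0` at `t = 0`, where derivative `j` vanishes.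
    have hB : ∀ t : ℝ, HasDerivAt (fun t : ℝ => ε * ‖x‖ ^ (m + 1) / (m + 1)! * t ^ (m + 1))
        (ε * (t * ‖x‖) ^ m / m ! * ‖x‖) t := by
      intro t
      refine ((hasDerivAt_pow (m + 1) t).const_mul (ε * ‖x‖ ^ (m + 1) / (m + 1)!)).congr_deriv ?_
      rw [Nat.factorial_succ]
      push_cast
      field_simp
      ring
    have := image_norm_le_of_norm_deriv_right_le_deriv_boundary
      (fun t ht => (hder t ht).continuousAt.continuousWithinAt)
      (fun t ht => (hder t (Ico_subset_Icc_self ht)).hasDerivWithinAt)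
      (by simp [h0 j (by omega)]) hB (fun t ht => by
        refine (ContinuousLinearMap.le_opNorm _ _).trans ?_
        gcongr
        rw [norm_fderiv_iteratedFDeriv]
        have := ih (j := j + 1) (by omega) (hmem t (Ico_subset_Icc_self ht))
        rwa [norm_smul, Real.norm_of_nonneg ht.1] at this) (right_mem_Icc.2 zero_le_one)
    simpa using this

end IteratedDerivative

variable {n : ℕ}

/-! ### The norms `M l` and operator norms of derivatives -/

section DerivNorm

/-- Expansion of a multilinear form in coordinates. -/
lemma multilinear_apply_eq_sum {l : ℕ}
    (m : ContinuousMultilinearMap ℝ (fun _ : Fin l => EuclideanSpace ℝ (Fin n)) ℝ)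
    (v : Fin l → EuclideanSpace ℝ (Fin n)) :
    m v = ∑ w : Fin l → Fin n, (∏ j, v j (w j)) *
      m (fun j => EuclideanSpace.single (w j) (1 : ℝ)) := by
  have hv : v = fun j => ∑ i : Fin n, v j i • EuclideanSpace.single i (1 : ℝ) := by
    funext j
    have := (EuclideanSpace.basisFun (Fin n) ℝ).sum_repr (v j)
    simpa using this.symm
  conv_lhs => rw [hv]
  rw [ContinuousMultilinearMap.map_sum]
  refine Finset.sum_congr rfl fun w _ => ?_
  rw [ContinuousMultilinearMap.map_smul_univ, smul_eq_mul]

/-- Each coordinate of a vector is at most its Euclidean norm. This passes from sums of partial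
derivatives to operator norms with constant `1`. -/
lemma norm_multilinear_le_sum {l : ℕ}
    (m : ContinuousMultilinearMap ℝ (fun _ : Fin l => EuclideanSpace ℝ (Fin n)) ℝ) :
    ‖m‖ ≤ ∑ w : Fin l → Fin n, |m (fun j => EuclideanSpace.single (w j) (1 : ℝ))| := by
  refine ContinuousMultilinearMap.opNorm_le_bound (Finset.sum_nonneg fun _ _ => abs_nonneg _)
    fun v => ?_
  rw [multilinear_apply_eq_sum, Real.norm_eq_abs, Finset.sum_mul]
  refine (Finset.abs_sum_le_sum_abs _ _).trans (Finset.sum_le_sum fun w _ => ?_)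
  rw [abs_mul, mul_comm, Finset.abs_prod]
  gcongr with j _
  exact PiLp.norm_apply_le (v j) (w j)

lemma unitBall_mem_nhds {x : EuclideanSpace ℝ (Fin n)}
    (hx : x ∈ ball (0 : EuclideanSpace ℝ (Fin n)) 1) : unitBall n ∈ 𝓝 x :=
  mem_of_superset (isOpen_ball.mem_nhds hx) ball_subset_closedBall

lemma uniqueDiffOn_unitBall : UniqueDiffOn ℝ (unitBall n) :=
  uniqueDiffOn_convex (convex_closedBall _ _)
    ⟨0, ball_subset_interior_closedBall (mem_ball_self one_pos)⟩

lemma iteratedFDerivWithin_unitBall (l : ℕ) (f : EuclideanSpace ℝ (Fin n) → ℝ)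
    {x : EuclideanSpace ℝ (Fin n)} (hx : x ∈ ball (0 : EuclideanSpace ℝ (Fin n)) 1) :
    iteratedFDerivWithin ℝ l f (unitBall n) x = iteratedFDeriv ℝ l f x := by
  rw [← iteratedFDerivWithin_univ]
  exact iteratedFDerivWithin_congr_set (eventuallyEq_univ.2 (unitBall_mem_nhds hx)) l

lemma derivNorm_nonneg (l : ℕ) (f : EuclideanSpace ℝ (Fin n) → ℝ) (x : EuclideanSpace ℝ (Fin n)) :
    0 ≤ derivNorm l f x :=
  Finset.sum_nonneg fun _ _ => abs_nonneg _

lemma M_nonneg (l : ℕ) (f : EuclideanSpace ℝ (Fin n) → ℝ) : 0 ≤ M l f :=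
  Real.sSup_nonneg (by rintro _ ⟨x, -, rfl⟩; exact derivNorm_nonneg l f x)

lemma derivNorm_zero (f : EuclideanSpace ℝ (Fin n) → ℝ) (x : EuclideanSpace ℝ (Fin n)) :
    derivNorm 0 f x = |f x| := by
  simp [derivNorm]

lemma derivNorm_le_M {l : ℕ} {f : EuclideanSpace ℝ (Fin n) → ℝ}
    (hf : ContDiffOn ℝ l f (unitBall n)) {x : EuclideanSpace ℝ (Fin n)}
    (hx : x ∈ unitBall n) : derivNorm l f x ≤ M l f := by
  -- A real `sSup` bounds its set only if the set is bounded above; here the derivative is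
  -- continuous on a compact ball.
  refine le_csSup ?_ (mem_image_of_mem _ hx)
  refine (isCompact_closedBall (0 : EuclideanSpace ℝ (Fin n)) 1).bddAbove_image ?_
  have := hf.continuousOn_iteratedFDerivWithin le_rfl uniqueDiffOn_unitBall
  exact continuousOn_finsetSum _ fun w _ => (this.eval_const _).abs

lemma M_le {l : ℕ} {f : EuclideanSpace ℝ (Fin n) → ℝ} {C : ℝ}
    (h : ∀ x ∈ unitBall n, derivNorm l f x ≤ C) : M l f ≤ C :=
  csSup_le ((nonempty_closedBall.2 zero_le_one).image _) (by rintro _ ⟨x, hx, rfl⟩; exact h x hx)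

lemma norm_iteratedFDeriv_le_M {l : ℕ} {f : EuclideanSpace ℝ (Fin n) → ℝ}
    (hf : ContDiffOn ℝ l f (unitBall n)) {x : EuclideanSpace ℝ (Fin n)}
    (hx : x ∈ ball (0 : EuclideanSpace ℝ (Fin n)) 1) : ‖iteratedFDeriv ℝ l f x‖ ≤ M l f := by
  rw [← iteratedFDerivWithin_unitBall l f hx]
  exact (norm_multilinear_le_sum _).trans (derivNorm_le_M hf (ball_subset_closedBall hx))

lemma abs_le_M_zero {f : EuclideanSpace ℝ (Fin n) → ℝ} (hf : ContinuousOn f (unitBall n))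
    {x : EuclideanSpace ℝ (Fin n)}
    (hx : x ∈ unitBall n) : |f x| ≤ M 0 f := by
  rw [← derivNorm_zero]
  exact derivNorm_le_M (by simpa using hf) hx

end DerivNorm

/-! ### Equivalence of norms on polynomials of bounded degree -/

section Polynomials

lemma contDiff_polyFun (p : MvPolynomial (Fin n) ℝ) {k : WithTop ℕ∞} :
    ContDiff ℝ k (polyFun p) := by
  induction p using MvPolynomial.induction_on with
  | C a =>
    have : polyFun (MvPolynomial.C a) = fun _ : EuclideanSpace ℝ (Fin n) => a := by
      funext x; simp [polyFun]
    rw [this]; exact contDiff_const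
  | add p q hp hq =>
    have : polyFun (p + q) = fun x => polyFun p x + polyFun q x := by
      funext x; simp [polyFun]
    rw [this]; exact hp.add hq
  | mul_X p i hp =>
    have : polyFun (p * MvPolynomial.X i) = fun x => polyFun p x * x i := by
      funext x; simp [polyFun]
    rw [this]; exact hp.mul (EuclideanSpace.proj (𝕜 := ℝ) i).contDiff

lemma polyFun_sum_smul {ι : Type*} (s : Finset ι) (c : ι → ℝ) (p : ι → MvPolynomial (Fin n) ℝ) :
    polyFun (∑ j ∈ s, c j • p j) = ∑ j ∈ s, c j • polyFun (p j) := by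
  funext x
  simp [polyFun, MvPolynomial.smul_eval, Finset.sum_apply]

lemma derivNorm_sum_smul_le {ι : Type*} (s : Finset ι) (c : ι → ℝ)
    (p : ι → MvPolynomial (Fin n) ℝ) (k : ℕ) {x : EuclideanSpace ℝ (Fin n)} (hx : x ∈ unitBall n) :
    derivNorm k (polyFun (∑ j ∈ s, c j • p j)) x ≤
      ∑ j ∈ s, |c j| * derivNorm k (polyFun (p j)) x := by
  have h : iteratedFDerivWithin ℝ k (polyFun (∑ j ∈ s, c j • p j)) (unitBall n) x =
      ∑ j ∈ s, c j • iteratedFDerivWithin ℝ k (polyFun (p j)) (unitBall n) x := by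
    rw [polyFun_sum_smul, iteratedFDerivWithin_sum_apply (f := fun j => c j • polyFun (p j))
      uniqueDiffOn_unitBall hx fun j _ =>
        ((contDiff_polyFun (p j)).const_smul (c j)).contDiffWithinAt]
    exact Finset.sum_congr rfl fun j _ => iteratedFDerivWithin_const_smul_apply
      (contDiff_polyFun (p j)).contDiffWithinAt uniqueDiffOn_unitBall hx
  simp only [derivNorm, h, Finset.mul_sum]
  rw [Finset.sum_comm]
  refine Finset.sum_le_sum fun w _ => ?_
  rw [_root_.sum_apply]
  refine (Finset.abs_sum_le_sum_abs _ _).trans (Finset.sum_le_sum fun j _ => ?_)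
  simp [abs_mul]

/-- The cube `[0, 1/(n+1)]^n` lies in the ball, since `x i ^ 2 ≤ 1/(n+1)`, and a polynomial
vanishing on a product of infinite sets is zero. -/
lemma polyFun_injective_on_ball {p : MvPolynomial (Fin n) ℝ}
    (h : ∀ x ∈ unitBall n, polyFun p x = 0) : p = 0 := by
  have hn : (0 : ℝ) < n + 1 := by positivity
  refine MvPolynomial.funext_set (fun _ => Icc (0 : ℝ) (1 / (n + 1)))
    (fun _ => Icc_infinite (by positivity)) fun x hx => ?_
  rw [map_zero]
  refine h (WithLp.toLp 2 x) ?_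
  rw [mem_closedBall, dist_zero_right, EuclideanSpace.norm_eq, Real.sqrt_le_one]
  have hx' : ∀ i, 0 ≤ x i ∧ x i ≤ 1 / (n + 1) := fun i => hx i (mem_univ i)
  have : ∀ i, ‖x i‖ ^ 2 ≤ 1 / (n + 1) := fun i => by
    rw [Real.norm_of_nonneg (hx' i).1]
    have h1 : 1 / ((n : ℝ) + 1) ≤ 1 := by
      rw [div_le_one hn]; linarith [Nat.cast_nonneg (α := ℝ) n]
    nlinarith [hx' i]
  calc ∑ i, ‖x i‖ ^ 2 ≤ ∑ _i : Fin n, 1 / ((n : ℝ) + 1) := Finset.sum_le_sum fun i _ => this i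
    _ = n / (n + 1) := by simp [div_eq_mul_inv]
    _ ≤ 1 := by rw [div_le_one hn]; linarith

/-- Coordinates in a finite-dimensional space are bounded by any norm on it. -/
lemma exists_coordinate_bound {ι V X : Type*} [Fintype ι] [AddCommGroup V] [Module ℝ V]
    [NormedAddCommGroup X] [NormedSpace ℝ X] (b : Module.Basis ι ℝ V) (ev : V →ₗ[ℝ] X)
    (hev : Function.Injective ev) :
    ∃ A : ℝ, 0 ≤ A ∧ ∀ p j, |b.equivFun p j| ≤ A * ‖ev p‖ := by
  have : FiniteDimensional ℝ V := b.finiteDimensional_of_finite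
  let Φ : LinearMap.range ev →ₗ[ℝ] (ι → ℝ) :=
    b.equivFun.toLinearMap.comp (LinearEquiv.ofInjective ev hev).symm.toLinearMap
  let Φc := LinearMap.toContinuousLinearMap Φ
  refine ⟨‖Φc‖, Φc.opNorm_nonneg, fun p j => ?_⟩
  have h : Φc (LinearEquiv.ofInjective ev hev p) = b.equivFun p := by simp [Φc, Φ]
  calc |b.equivFun p j| ≤ ‖b.equivFun p‖ := norm_le_pi_norm (b.equivFun p) j
    _ = ‖Φc (LinearEquiv.ofInjective ev hev p)‖ := by rw [h]
    _ ≤ ‖Φc‖ * ‖ev p‖ := Φc.le_opNorm _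

/-- On polynomials of bounded degree, all the norms of derivatives are bounded by the maximum
norm. -/
lemma exists_derivative_bound (n d : ℕ) :
    ∃ C : ℝ, 0 ≤ C ∧ ∀ p : MvPolynomial (Fin n) ℝ, p.totalDegree ≤ d →
      ∀ k ∈ Finset.Icc 1 d, M k (polyFun p) ≤ C * M 0 (polyFun p) := by
  let V := MvPolynomial.restrictTotalDegree (Fin n) ℝ d
  have : CompactSpace (unitBall n) := isCompact_iff_compactSpace.1 (isCompact_closedBall 0 1)
  let ev : V →ₗ[ℝ] C(unitBall n, ℝ) :=
    { toFun := fun p => ⟨fun x => polyFun p.1 x.1,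
        (contDiff_polyFun p.1 (k := 0)).continuous.comp continuous_subtype_val⟩
      map_add' := fun p q => by ext x; simp [polyFun]
      map_smul' := fun c p => by ext x; simp [polyFun, MvPolynomial.smul_eval] }
  have hev : Function.Injective ev := by
    rw [injective_iff_map_eq_zero]
    intro p hp
    exact Subtype.ext (polyFun_injective_on_ball fun x hx => DFunLike.congr_fun hp ⟨x, hx⟩)
  let b := Module.finBasis ℝ V
  obtain ⟨A, hA0, hA⟩ := exists_coordinate_bound b ev hev
  have hcoord : ∀ p : V, ∀ j, |b.equivFun p j| ≤ A * M 0 (polyFun p.1) := by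
    intro p j
    refine (hA p j).trans (mul_le_mul_of_nonneg_left ?_ hA0)
    rw [ContinuousMap.norm_le _ (M_nonneg _ _)]
    intro x
    exact abs_le_M_zero (contDiff_polyFun p.1 (k := 0)).continuous.continuousOn x.2
  let D : ℕ → ℝ := fun k => ∑ j, A * M k (polyFun (b j).1)
  have hD : ∀ k, 0 ≤ D k := fun k =>
    Finset.sum_nonneg fun j _ => mul_nonneg hA0 (M_nonneg _ _)
  -- Summing over `k` gives one constant for all orders.
  refine ⟨∑ k ∈ Finset.Icc 1 d, D k, Finset.sum_nonneg fun k _ => hD k, fun p hp k hk => ?_⟩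
  let P : V := ⟨p, (MvPolynomial.mem_restrictTotalDegree _ _ _).2 hp⟩
  have hsum : p = ∑ j, b.equivFun P j • (b j).1 := by
    refine (congrArg Subtype.val (b.sum_equivFun P)).symm.trans ?_
    rw [Submodule.coe_sum]
    rfl
  have hMk : M k (polyFun p) ≤ D k * M 0 (polyFun p) := by
    refine M_le fun x hx => ?_
    conv_lhs => rw [hsum]
    refine (derivNorm_sum_smul_le _ _ _ k hx).trans ?_
    rw [Finset.sum_mul]
    refine Finset.sum_le_sum fun j _ => ?_
    rw [mul_right_comm]
    have h1 := derivNorm_le_M (contDiff_polyFun (b j).1 (k := k)).contDiffOn hx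
    exact mul_le_mul (hcoord P j) h1 (derivNorm_nonneg _ _ _)
      (mul_nonneg hA0 (M_nonneg _ _))
  exact hMk.trans (mul_le_mul_of_nonneg_right
    (Finset.single_le_sum (f := D) (fun k _ => hD k) hk) (M_nonneg _ _))

lemma polyConst_nonneg (n d : ℕ) : 0 ≤ polyConst n d := Real.sInf_nonneg fun _ hC => hC.1

/-- The infimum in the definition of `polyConst` is attained. -/
lemma M_polyFun_le {d k : ℕ} {p : MvPolynomial (Fin n) ℝ} (hp : p.totalDegree ≤ d)
    (hk : k ∈ Finset.Icc 1 d) : M k (polyFun p) ≤ polyConst n d * M 0 (polyFun p) := by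
  obtain ⟨C, hC0, hC⟩ := exists_derivative_bound n d
  -- If `M 0` vanishes one cannot divide by it, but any admissible `C` already gives `M k ≤ 0`.
  rcases (M_nonneg 0 (polyFun p)).eq_or_lt with h0 | h0
  · have := hC p hp k hk
    rw [← h0, mul_zero] at this ⊢
    exact this
  · rw [← div_le_iff₀ h0]
    refine le_csInf ⟨C, hC0, hC⟩ fun C' hC' => ?_
    rw [div_le_iff₀ h0]
    exact hC'.2 p hp k hk

end Polynomials

/-! ### The Taylor polynomial and its remainder -/

section Taylor

lemma exists_polyFun_eq_taylorPoly (d : ℕ) (f : EuclideanSpace ℝ (Fin n) → ℝ) :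
    ∃ p : MvPolynomial (Fin n) ℝ, p.totalDegree ≤ d ∧ polyFun p = taylorPoly d f := by
  refine ⟨∑ k ∈ Finset.range (d + 1), ∑ w : Fin k → Fin n,
    MvPolynomial.C (iteratedFDerivWithin ℝ k f (unitBall n) 0
      (fun j => EuclideanSpace.single (w j) (1 : ℝ)) / (k ! : ℝ)) * ∏ j, MvPolynomial.X (w j),
    ?_, ?_⟩
  · refine MvPolynomial.totalDegree_finsetSum_le fun k hk =>
      MvPolynomial.totalDegree_finsetSum_le fun w _ => ?_
    refine (MvPolynomial.totalDegree_mul _ _).trans ?_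
    rw [MvPolynomial.totalDegree_C, zero_add]
    refine (MvPolynomial.totalDegree_finsetProd _ _).trans ?_
    simp only [MvPolynomial.totalDegree_X, Finset.sum_const, Finset.card_univ, Fintype.card_fin,
      smul_eq_mul, mul_one]
    exact Nat.lt_succ_iff.1 (Finset.mem_range.1 hk)
  · funext x
    simp only [polyFun, taylorPoly, map_sum, map_mul, MvPolynomial.eval_C, map_prod,
      MvPolynomial.eval_X]
    refine Finset.sum_congr rfl fun k _ => ?_
    rw [multilinear_apply_eq_sum, Finset.sum_div]
    exact Finset.sum_congr rfl fun w _ => by ring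

/-- The Taylor polynomial as a formal power series. -/
noncomputable def taylorSeries (d : ℕ) (f : EuclideanSpace ℝ (Fin n) → ℝ) :
    FormalMultilinearSeries ℝ (EuclideanSpace ℝ (Fin n)) ℝ :=
  fun k => if k ≤ d then (k ! : ℝ)⁻¹ • iteratedFDerivWithin ℝ k f (unitBall n) 0 else 0

/-- As a finite power series, the Taylor polynomial has its derivatives given by its coefficients,
at the origin and, after recentring, everywhere. -/
lemma hasFiniteFPowerSeriesOnBall_taylorPoly (d : ℕ) (f : EuclideanSpace ℝ (Fin n) → ℝ) :
    HasFiniteFPowerSeriesOnBall (taylorPoly d f) (taylorSeries d f) 0 (d + 1) ⊤ := by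
  refine .mk' (fun m hm => if_neg (by omega)) (by simp) fun y _ => ?_
  rw [zero_add, taylorPoly]
  refine Finset.sum_congr rfl fun k hk => ?_
  rw [taylorSeries, if_pos (Nat.lt_succ_iff.1 (Finset.mem_range.1 hk))]
  simp [div_eq_inv_mul]

/-- The derivative of a power series at its centre is the sum of its coefficient over all
permutations of the arguments. The coefficient `D^j f(0) / j!` is symmetric, so the `j!` terms
coincide. -/
lemma iteratedFDeriv_taylorPoly_zero {d : ℕ} {f : EuclideanSpace ℝ (Fin n) → ℝ}
    (hf : ContDiffOn ℝ (d + 1 : ℕ) f (unitBall n)) {j : ℕ} (hj : j ≤ d) : iteratedFDeriv ℝ j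
    (taylorPoly d f) 0 = iteratedFDeriv ℝ j f 0 := by
  have h0 : (0 : EuclideanSpace ℝ (Fin n)) ∈ ball (0 : EuclideanSpace ℝ (Fin n)) 1 :=
    mem_ball_self one_pos
  have hfj : ContDiffAt ℝ j f 0 := (hf.contDiffAt (unitBall_mem_nhds h0)).of_le
    (by exact_mod_cast hj.trans (Nat.le_succ d))
  ext v
  rw [(hasFiniteFPowerSeriesOnBall_taylorPoly d
    f).toHasFPowerSeriesOnBall.iteratedFDeriv_eq_sum_of_completeSpace]
  have : ∀ σ : Equiv.Perm (Fin j), taylorSeries d f j (fun i => v (σ i)) =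
      (j ! : ℝ)⁻¹ * iteratedFDeriv ℝ j f 0 v := by
    intro σ
    rw [taylorSeries, if_pos hj, iteratedFDerivWithin_unitBall j f h0,
      _root_.smul_apply, smul_eq_mul]
    congr 1
    exact iteratedFDeriv_comp_perm_of_contDiffAt hfj v σ
  simp only [this, Finset.sum_const, Finset.card_univ, Fintype.card_perm, Fintype.card_fin,
    nsmul_eq_mul]
  field_simp

/-- Recentring a finite power series at `x` does not raise its degree. -/
lemma iteratedFDeriv_taylorPoly_of_lt {d j : ℕ} (f : EuclideanSpace ℝ (Fin n) → ℝ) (hj : d < j)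
    (x : EuclideanSpace ℝ (Fin n)) :
    iteratedFDeriv ℝ j (taylorPoly d f) x = 0 := by
  have h := (hasFiniteFPowerSeriesOnBall_taylorPoly d f).changeOrigin (y := x)
    (ENNReal.coe_lt_top)
  rw [zero_add] at h
  ext v
  rw [h.toHasFPowerSeriesOnBall.iteratedFDeriv_eq_sum_of_completeSpace]
  simp [h.finite j hj]

lemma contDiff_taylorPoly (d : ℕ) (f : EuclideanSpace ℝ (Fin n) → ℝ) {k : WithTop ℕ∞} :
    ContDiff ℝ k (taylorPoly d f) := by
  obtain ⟨p, -, hp⟩ := exists_polyFun_eq_taylorPoly d f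
  exact hp ▸ contDiff_polyFun p

/-- Taylor's inequality on the unit ball, for the function and its derivatives. -/
lemma norm_iteratedFDeriv_sub_taylorPoly_le {d : ℕ} {f : EuclideanSpace ℝ (Fin n) → ℝ}
    (hf : ContDiffOn ℝ (d + 1 : ℕ) f (unitBall n)) {m j : ℕ} (hjm : j + m = d + 1)
    {x : EuclideanSpace ℝ (Fin n)}
    (hx : x ∈ ball (0 : EuclideanSpace ℝ (Fin n)) 1) :
    ‖iteratedFDeriv ℝ j f x - iteratedFDeriv ℝ j (taylorPoly d f) x‖ ≤
      M (d + 1) f * ‖x‖ ^ m / m ! := by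
  have hsub : ∀ y ∈ ball (0 : EuclideanSpace ℝ (Fin n)) 1, ∀ i ≤ d + 1,
      iteratedFDeriv ℝ i (f - taylorPoly d f) y =
        iteratedFDeriv ℝ i f y - iteratedFDeriv ℝ i (taylorPoly d f) y := fun y hy i hi =>
    iteratedFDeriv_sub_apply ((hf.contDiffAt (unitBall_mem_nhds hy)).of_le (by exact_mod_cast hi))
      (contDiff_taylorPoly d f).contDiffAt
  rw [← hsub x hx j (by omega)]
  refine norm_iteratedFDeriv_le_of_vanishing (R := f - taylorPoly d f) isOpen_ball
    ((convex_ball _ _).starConvex (mem_ball_self one_pos))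
    ((hf.mono ball_subset_closedBall).sub (contDiff_taylorPoly d f).contDiffOn) ?_ ?_ hjm hx
  · intro i hi
    rw [hsub 0 (mem_ball_self one_pos) i (by omega), iteratedFDeriv_taylorPoly_zero hf hi, sub_self]
  · intro y hy
    rw [hsub y hy _ le_rfl, iteratedFDeriv_taylorPoly_of_lt f (Nat.lt_succ_self d), sub_zero]
    exact norm_iteratedFDeriv_le_M hf hy

end Taylor

variable {n : ℕ}

/-! ### Gradients and the constant `C₃` -/

lemma norm_gradient_sub_le_norm_iteratedFDeriv_sub (f g : EuclideanSpace ℝ (Fin n) → ℝ)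
    (x : EuclideanSpace ℝ (Fin n)) :
    ‖∇ f x - ∇ g x‖ ≤ ‖iteratedFDeriv ℝ 1 f x - iteratedFDeriv ℝ 1 g x‖ := by
  rw [← norm_fderiv_sub_fderiv]
  refine ContinuousLinearMap.opNorm_le_bound _ (norm_nonneg _) fun v => ?_
  have := (iteratedFDeriv ℝ 1 f x - iteratedFDeriv ℝ 1 g x).le_opNorm (fun _ => v)
  simpa using this

lemma norm_gradient_le_norm_iteratedFDeriv (f : EuclideanSpace ℝ (Fin n) → ℝ)
    (x : EuclideanSpace ℝ (Fin n)) :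
    ‖∇ f x‖ ≤ ‖iteratedFDeriv ℝ 1 f x‖ := by
  rw [norm_iteratedFDeriv_one, ← toDual_gradient, LinearIsometryEquiv.norm_map]

lemma norm_gradient_sub_le_of_norm_iteratedFDeriv_two_le {f : EuclideanSpace ℝ (Fin n) → ℝ}
    (hf : ContDiff ℝ 2 f)
    {K : ℝ} {s : Set (EuclideanSpace ℝ (Fin n))} (hs : Convex ℝ s)
    (hK : ∀ x ∈ s, ‖iteratedFDeriv ℝ 2 f x‖ ≤ K) {x y : EuclideanSpace ℝ (Fin n)}
    (hx : x ∈ s) (hy : y ∈ s) : ‖∇ f y - ∇ f x‖ ≤ K * ‖y - x‖ := by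
  rw [← norm_fderiv_sub_fderiv]
  have hd : Differentiable ℝ (fderiv ℝ f) :=
    (hf.fderiv_right (m := 1) (by norm_num)).differentiable one_ne_zero
  refine hs.norm_image_sub_le_of_norm_fderiv_le (𝕜 := ℝ) (fun z _ => hd z) (fun z hz => ?_) hx hy
  rw [← norm_iteratedFDeriv_one, norm_iteratedFDeriv_fderiv]
  exact hK z hz

/-- The first summand bounds every derivative of `P` of positive order; the second absorbs `∇f - ∇P`
in the proof of `γ ≤ C₃`, and keeps `C₃` positive. -/
lemma C₃_eq (n d : ℕ) :
    C₃ n d = polyConst n d * (1 + 1 / ((d + 1)! : ℝ)) + 1 / ((d - 1)! : ℝ) := by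
  rw [C₃, C₁, C₂]
  ring

lemma C₃_pos (n d : ℕ) : 0 < C₃ n d := by
  rw [C₃_eq]
  have := polyConst_nonneg n d
  positivity

/-! ### The hypotheses of the theorem give nearby zero sets -/

section Estimates

variable {d : ℕ} {f : EuclideanSpace ℝ (Fin n) → ℝ}

lemma M_zero_taylorPoly_le (hf : ContDiffOn ℝ (d + 1 : ℕ) f (unitBall n)) (hM0 : M 0 f = 1)
    (hM : M (d + 1) f ≤ 1) : M 0 (taylorPoly d f) ≤ 1 + 1 / ((d + 1)! : ℝ) := by
  refine M_le fun x hx => ?_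
  rw [derivNorm_zero]
  -- The remainder estimate is available on the open ball; continuity of `P` carries the bound to
  -- the boundary.
  have hcl : IsClosed {y : EuclideanSpace ℝ (Fin n) | |taylorPoly d f y| ≤ 1 + 1 / ((d + 1)! : ℝ)} :=
    isClosed_le (contDiff_taylorPoly d f (k := 0)).continuous.abs continuous_const
  have hx' : x ∈ closure (ball (0 : EuclideanSpace ℝ (Fin n)) 1) :=
    by rwa [closure_ball _ one_ne_zero]
  suffices hsub : ball (0 : EuclideanSpace ℝ (Fin n)) 1 ⊆
    {y : EuclideanSpace ℝ (Fin n) | |taylorPoly d f y| ≤ 1 + 1 / ((d + 1)! : ℝ)} from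
    closure_minimal hsub hcl hx'
  intro y hy
  have h1 := norm_iteratedFDeriv_sub_taylorPoly_le hf (zero_add (d + 1)) hy
  have h2 : |f y - taylorPoly d f y| ≤ ‖iteratedFDeriv ℝ 0 f y -
      iteratedFDeriv ℝ 0 (taylorPoly d f) y‖ := by
    simpa using (iteratedFDeriv ℝ 0 f y - iteratedFDeriv ℝ 0 (taylorPoly d f) y).le_opNorm 0
  have h3 : |f y| ≤ 1 := hM0 ▸ abs_le_M_zero hf.continuousOn (ball_subset_closedBall hy)
  have h4 : M (d + 1) f * ‖y‖ ^ (d + 1) / (d + 1)! ≤ 1 / ((d + 1)! : ℝ) := by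
    have hy1 : ‖y‖ ≤ 1 := (mem_ball_zero_iff.1 hy).le
    have := mul_le_one₀ hM (by positivity) (pow_le_one₀ (n := d + 1) (norm_nonneg y) hy1)
    gcongr
  have h5 := abs_sub_abs_le_abs_sub (taylorPoly d f y) (f y)
  rw [abs_sub_comm] at h5
  simp only [mem_ofPred_eq]
  linarith

lemma norm_iteratedFDeriv_taylorPoly_le (hf : ContDiffOn ℝ (d + 1 : ℕ) f (unitBall n))
    (hM0 : M 0 f = 1) (hM : M (d + 1) f ≤ 1) {k : ℕ} (hk : 1 ≤ k) {x : EuclideanSpace ℝ (Fin n)}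
    (hx : x ∈ ball (0 : EuclideanSpace ℝ (Fin n)) 1) :
    ‖iteratedFDeriv ℝ k (taylorPoly d f) x‖ ≤ polyConst n d * (1 + 1 / ((d + 1)! : ℝ)) := by
  have hc := polyConst_nonneg n d
  rcases le_or_gt k d with hkd | hkd
  · obtain ⟨p, hpd, hp⟩ := exists_polyFun_eq_taylorPoly d f
    refine (norm_iteratedFDeriv_le_M (contDiff_taylorPoly d f).contDiffOn hx).trans ?_
    have h1 := M_polyFun_le hpd (Finset.mem_Icc.2 ⟨hk, hkd⟩)
    rw [hp] at h1
    exact h1.trans (mul_le_mul_of_nonneg_left (M_zero_taylorPoly_le hf hM0 hM) hc)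
  -- Orders above `d`, which `polyConst` does not control, vanish; order `2` falls here when `d =
  -- 1`.
  · rw [iteratedFDeriv_taylorPoly_of_lt f hkd, norm_zero]
    positivity

lemma norm_gradient_sub_gradient_taylorPoly_le (hf : ContDiffOn ℝ (d + 1 : ℕ) f (unitBall n))
    {x : EuclideanSpace ℝ (Fin n)} (hx : x ∈ ball (0 : EuclideanSpace ℝ (Fin n)) 1) :
    ‖∇ f x - ∇ (taylorPoly d f) x‖ ≤ M (d + 1) f / d ! * ‖x‖ ^ d := by
  refine (norm_gradient_sub_le_norm_iteratedFDeriv_sub _ _ _).trans ?_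
  refine (norm_iteratedFDeriv_sub_taylorPoly_le hf (add_comm 1 d) hx).trans_eq ?_
  ring

lemma abs_sub_taylorPoly_le (hf : ContDiffOn ℝ (d + 1 : ℕ) f (unitBall n))
    {x : EuclideanSpace ℝ (Fin n)} (hx : x ∈ ball (0 : EuclideanSpace ℝ (Fin n)) 1) :
    |f x - taylorPoly d f x| ≤ M (d + 1) f / (d + 1)! * ‖x‖ ^ (d + 1) := by
  have h2 : |f x - taylorPoly d f x| ≤ ‖iteratedFDeriv ℝ 0 f x -
      iteratedFDeriv ℝ 0 (taylorPoly d f) x‖ := by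
    simpa using (iteratedFDeriv ℝ 0 f x - iteratedFDeriv ℝ 0 (taylorPoly d f) x).le_opNorm 0
  refine (h2.trans (norm_iteratedFDeriv_sub_taylorPoly_le hf (zero_add (d + 1)) hx)).trans_eq ?_
  ring

/-- Under the hypotheses of the rigidity theorem, the zero set of `f`, if nonempty, is close to
that of the Taylor polynomial. -/
lemma isNearbyZeroSet_taylorPoly {γ : ℝ} (hγ : 0 < γ)
    (hf : ContDiffOn ℝ (d + 1 : ℕ) f (unitBall n)) (hM0 : M 0 f = 1)
    (hzeros : ∀ x ∈ unitBall n, f x = 0 → x ∈ closedBall (0 : EuclideanSpace ℝ (Fin n)) (1 / 2))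
    (hreg : IsGammaRegularValue γ f 0) (hT : M (d + 1) f ≤ T n d γ)
    (hne : (zeroLevel f).Nonempty) :
    IsNearbyZeroSet (d + 1) (C₃ n d) γ f (taylorPoly d f) (zeroLevel f) := by
  have hK := C₃_pos n d
  set K := C₃ n d with hKdef
  set A := polyConst n d * (1 + 1 / ((d + 1)! : ℝ)) with hA
  have hKA : K = A + 1 / ((d - 1)! : ℝ) := C₃_eq n d
  have hd0 : (0 : ℝ) < d ! := by positivity
  have hM1 : M (d + 1) f ≤ 1 := hT.trans (min_le_left _ _)
  have hM2 : M (d + 1) f / d ! ≤ γ ^ 2 / (4 * K) := by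
    rw [div_le_iff₀ hd0]
    exact (hT.trans (min_le_right _ _)).trans_eq (by ring)
  have hMn : 0 ≤ M (d + 1) f := M_nonneg _ _
  have hA0 : 0 ≤ A := by
    have := polyConst_nonneg n d
    positivity
  have hsub : zeroLevel f ⊆ closedBall 0 (1 / 2) := fun x hx => hzeros x hx.1 hx.2
  have hsub' : zeroLevel f ⊆ ball 0 1 := hsub.trans (closedBall_subset_ball (by norm_num))
  have hgrad : ∀ y ∈ zeroLevel f, γ ≤ ‖∇ f y‖ := by
    intro y hy
    have h := hreg y hy.1 hy.2
    have hy' : unitBall n ∈ 𝓝 y := unitBall_mem_nhds (hsub' hy)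
    rwa [gradientWithin, fderivWithin_of_mem_nhds hy'] at h
  have hhalf : ∀ y ∈ zeroLevel f, ‖y‖ ≤ 1 / 2 := fun y hy => mem_closedBall_zero_iff.1 (hsub hy)
  have hder : ∀ k, 1 ≤ k → ∀ x ∈ ball (0 : EuclideanSpace ℝ (Fin n)) 1, ‖iteratedFDeriv ℝ k
    (taylorPoly d f) x‖ ≤ A :=
    fun k hk x hx => norm_iteratedFDeriv_taylorPoly_le hf hM0 hM1 hk hx
  have hpow : ∀ x ∈ ball (0 : EuclideanSpace ℝ (Fin n)) 1, ∀ k, ‖x‖ ^ k ≤ 1 := fun x hx k =>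
    pow_le_one₀ (norm_nonneg x) (mem_ball_zero_iff.1 hx).le
  have hdiv : 0 ≤ M (d + 1) f / d ! := by positivity
  have hclose : ∀ x ∈ ball (0 : EuclideanSpace ℝ (Fin n)) 1,
      ‖∇ f x - ∇ (taylorPoly d f) x‖ ≤ M (d + 1) f / d ! := fun x hx =>
    (norm_gradient_sub_gradient_taylorPoly_le hf hx).trans
    (mul_le_of_le_one_right hdiv (hpow x hx d))
  have hfac : M (d + 1) f / d ! ≤ 1 / ((d - 1)! : ℝ) := by
    have : ((d - 1)! : ℝ) ≤ d ! := by exact_mod_cast Nat.factorial_le (Nat.sub_le d 1)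
    gcongr
  -- A zero `y` gives `γ ≤ ‖∇f(y)‖ ≤ A + 1/(d-1)! = K`; without zeros `γ` could be arbitrarily
  -- large.
  have hγK : γ ≤ K := by
    obtain ⟨y, hy⟩ := hne
    have h1 := hgrad y hy
    have h2 := norm_le_norm_add_norm_sub' (∇ f y) (∇ (taylorPoly d f) y)
    have h3 := (norm_gradient_le_norm_iteratedFDeriv (taylorPoly d f) y).trans
      (hder 1 le_rfl y (hsub' hy))
    linarith [hclose y (hsub' hy)]
  have hq : γ ^ 2 / (4 * K) ≤ γ / 4 := by
    rw [div_le_div_iff₀ (by positivity) (by norm_num)]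
    nlinarith
  -- For `d = 0` the polynomial is constant, so `γ ≤ ‖∇f(y)‖ ≤ γ / 4` at a zero of `f`.
  have hd : 1 ≤ d := by
    by_contra hd
    obtain rfl : d = 0 := by omega
    obtain ⟨y, hy⟩ := hne
    have h1 := hgrad y hy
    have h2 := hclose y (hsub' hy)
    have h3 := norm_gradient_le_norm_iteratedFDeriv (taylorPoly 0 f) y
    rw [iteratedFDeriv_taylorPoly_of_lt f one_pos, norm_zero] at h3
    have h4 := norm_le_norm_add_norm_sub' (∇ f y) (∇ (taylorPoly 0 f) y)
    linarith
  have hpow' : ∀ y ∈ zeroLevel f, ∀ k m : ℕ, m ≤ k → ‖y‖ ^ k ≤ (1 / 2) ^ m := fun y hy k m hm =>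
    (pow_le_pow_left₀ (norm_nonneg y) (hhalf y hy) k).trans
      (pow_le_pow_of_le_one (by norm_num) (by norm_num) hm)
  refine ⟨Nat.succ_ne_zero d, hγ, hγK, contDiff_taylorPoly d f, hf.mono ball_subset_closedBall,
    fun x hx y hy => ?_, fun x hx => (hclose x hx).trans (hM2.trans hq), fun x hx => ?_, hsub,
    fun y hy => ?_, fun y hy => ?_⟩
  · refine norm_gradient_sub_le_of_norm_iteratedFDeriv_two_le (contDiff_taylorPoly d f)
      (convex_ball _ _) (fun z hz => (hder 2 one_le_two z hz).trans ?_) hx hy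
    have : (0 : ℝ) ≤ 1 / ((d - 1)! : ℝ) := by positivity
    linarith
  · exact ⟨fun h => h.2, fun h => ⟨ball_subset_closedBall hx, h⟩⟩
  · have h1 := norm_gradient_sub_gradient_taylorPoly_le hf (hsub' hy)
    have h2 := norm_le_norm_add_norm_sub' (∇ f y) (∇ (taylorPoly d f) y)
    -- The zeros lie in the half ball and `d ≥ 1`: the extra factor `1/2` improves the error `γ / 4`
    -- to `γ / 8`.
    have h3 : M (d + 1) f / d ! * ‖y‖ ^ d ≤ γ / 4 * (1 / 2) ^ 1 :=
      mul_le_mul (hM2.trans hq) (hpow' y hy d 1 hd) (by positivity) (by positivity)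
    linarith [hgrad y hy]
  · have h1 := abs_sub_taylorPoly_le hf (hsub' hy)
    rw [hy.2, zero_sub, abs_neg] at h1
    refine h1.trans ?_
    -- One factor `1/2` comes from `d + 1 ≥ 2` in the factorial; two more come from `‖y‖ ^ (d + 1)`.
    have h2 : M (d + 1) f / (d + 1)! ≤ γ ^ 2 / (4 * K) / 2 := by
      rw [Nat.factorial_succ, Nat.cast_mul, mul_comm, ← div_div]
      have : (2 : ℝ) ≤ (d + 1 : ℕ) := by exact_mod_cast Nat.succ_le_succ hd
      gcongr
    calc M (d + 1) f / (d + 1)! * ‖y‖ ^ (d + 1) ≤ γ ^ 2 / (4 * K) / 2 * (1 / 2) ^ 2 :=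
          mul_le_mul h2 (hpow' y hy (d + 1) 2 (by omega)) (by positivity) (by positivity)
      _ = γ ^ 2 / (32 * K) := by field_simp; norm_num

end Estimates

end SmoothRigidity

theorem theorem7p1 (n d : ℕ) (γ : ℝ) (hγ : 0 < γ)
    (f : EuclideanSpace ℝ (Fin n) → ℝ)
    (hf : ContDiffOn ℝ ((d + 1 : ℕ) : WithTop ℕ∞) f (SmoothRigidity.unitBall n))
    (hM0 : SmoothRigidity.M 0 f = 1)
    (hzeros : ∀ x ∈ SmoothRigidity.unitBall n, f x = 0 →
      x ∈ Metric.closedBall (0 : EuclideanSpace ℝ (Fin n)) (1 / 2))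
    (hreg : SmoothRigidity.IsGammaRegularValue γ f 0)
    (hT : SmoothRigidity.M (d + 1) f ≤ SmoothRigidity.T n d γ) :
    ∃ (q : ℕ) (V W : Fin q → Set (EuclideanSpace ℝ (Fin n))),
      Function.Injective V ∧
      Set.range V = SmoothRigidity.components (SmoothRigidity.zeroLevel f) ∧
      Function.Injective W ∧
      (∀ i, W i ∈ SmoothRigidity.components
        {x : EuclideanSpace ℝ (Fin n) | SmoothRigidity.taylorPoly d f x = 0}) ∧
      (∀ i, ∀ x ∈ W i, gradient (SmoothRigidity.taylorPoly d f) x ≠ 0) ∧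
      SmoothRigidity.IsotopicIn ((d + 1 : ℕ) : WithTop ℕ∞) (SmoothRigidity.unitBall n)
        (SmoothRigidity.zeroLevel f) (⋃ i, W i) := by
  -- Without zeros, `γ ≤ C₃` and `d ≥ 1` may fail, but the theorem holds trivially with `q = 0`.
  rcases (SmoothRigidity.zeroLevel f).eq_empty_or_nonempty with hY | hY
  · rw [hY]
    refine ⟨0, Fin.elim0, Fin.elim0, fun i => i.elim0, ?_, fun i => i.elim0, fun i => i.elim0,
      fun i => i.elim0, fun a => a.1, ?_, by simp, fun τ _ => ⟨?_, id, ?_, by simp⟩, by simp,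
      by simp⟩
    · ext C
      simp [SmoothRigidity.components]
    · rintro x ⟨hx, -⟩
      exact hx.elim
    · exact fun x hx => hx.elim
    · rintro _ ⟨x, hx, -⟩
      exact hx.elim
  · exact (SmoothRigidity.isNearbyZeroSet_taylorPoly hγ hf hM0 hzeros hreg hT hY).exists_isotopy
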